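/- Let $(\mathcal A,[\cdot,\cdot],\rho)$ be a Lie algebroid over a smooth manifold $M$, let $E$ be a (smooth, real) vector bundle over $M$, and let $\Omega^k(\mathcal A,E)=\Gamma(\wedge^k\mathcal A^*\otimes E)$, viewed as the space of skew-symmetric $C^\infty(M)$-multilinear maps $\Gamma(\mathcal A)^k\to\Gamma(E)$, and $\Omega^*(\mathcal A,E)=\bigoplus_{k\ge 0}\Omega^k(\mathcal A,E)$. Write $\mathrm{Sh}_{k_1,\dots,k_r}$ for the set of $(k_1,\dots,k_r)$-shuffles. An $\mathcal A$-connection on $E$ is an $\mathbb R$-bilinear map $\nabla\colon\Gamma(\mathcal A)\times\Gamma(E)\to\Gamma(E)$ that is $C^\infty(M)$-linear in the first argument and satisfies $\nabla_X(fs)=(\rho(X)f)s+f\nabla_Xs$. Its curvature is $R(X,Y)s=\nabla_X\nabla_Ys-\nabla_Y\nabla_Xs-\nabla_{[X,Y]}s$, and it is flat (a representation of $\mathcal A$) if $R=0$. An $\mathcal A$-connection on $\mathcal A$ is torsion-free if $\nabla_XY-\nabla_YX=[X,Y]$ for all $X,Y\in\Gamma(\mathcal A)$. For a connection on $E$ and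 $\omega\in\Omega^p(\mathcal A,E)$ put $$(d^\nabla\omega)(Z_1,\dots,Z_{p+1})=\sum_{\sigma\in\mathrm{Sh}_{1,p}}(-1)^\sigma\nabla_{Z_{\sigma(1)}}\bigl(\omega(Z_{\sigma(2)},\dots,Z_{\sigma(p+1)})\bigr)-\sum_{\sigma\in\mathrm{Sh}_{2,p-1}}(-1)^\sigma\omega\bigl([Z_{\sigma(1)},Z_{\sigma(2)}],Z_{\sigma(3)},\dots,Z_{\sigma(p+1)}\bigr).$$ For $\phi\in\Omega^k(\mathcal A,\mathcal A)$ let $i_\phi$ be the operator on $\Omega^*(\mathcal A,E)$ that is zero on $\Omega^0(\mathcal A,E)$ and, for $\omega\in\Omega^{m+1}(\mathcal A,E)$, is given by $$(i_\phi\omega)(Z_1,\dots,Z_{k+m})=\sum_{\sigma\in\mathrm{Sh}_{k,m}}(-1)^\sigma\omega\bigl(\phi(Z_{\sigma(1)},\dots,Z_{\sigma(k)}),Z_{\sigma(k+1)},\dots,Z_{\sigma(k+m)}\bigr).$$ Fix an $\mathcal A$-connection on $\mathcal A$ and one on $E$. For $\phi\in\Omega^k(\mathcal A,\mathcal A)$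 define on $\Omega^*(\mathcal A,E)$ $$\mathcal L^\nabla_\phi=i_\phi d^\nabla+(-1)^kd^\nabla i_\phi,\qquad \nabla_\phi=\mathcal L^\nabla_\phi-(-1)^k\,i_{d^\nabla\phi},$$ where $d^\nabla\phi$ is formed with the connection on $\mathcal A$ and $\mathcal L^\nabla_\phi$ with the connection on $E$; on $\Omega^*(\mathcal A,\mathcal A)$ both are formed with the connection on $\mathcal A$. With $R$ the curvature of the connection on $\mathcal A$, define $R(\phi,\psi)\in\Omega^{k+l+1}(\mathcal A,\mathcal A)$ for $\phi\in\Omega^k(\mathcal A,\mathcal A)$, $\psi\in\Omega^l(\mathcal A,\mathcal A)$ by $$R(\phi,\psi)(Y_1,\dots,Y_{k+l+1})=\sum_{\sigma\in\mathrm{Sh}_{k,l,1}}(-1)^\sigma R\bigl(\phi(Y_{\sigma(1)},\dots,Y_{\sigma(k)}),\psi(Y_{\sigma(k+1)},\dots,Y_{\sigma(k+l)})\bigr)Y_{\sigma(k+l+1)}.$$ **Theorem.** Suppose that the $\mathcal A$-connection on $\mathcal A$ is torsion-free and that the $\mathcal A$-connection on $E$ is flat. Then for all $k,l\ge 0$,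 $\phi\in\Omega^k(\mathcal A,\mathcal A)$ and $\psi\in\Omega^l(\mathcal A,\mathcal A)$, the graded commutator $[\nabla_\phi,\nabla_\psi]=\nabla_\phi\nabla_\psi-(-1)^{kl}\nabla_\psi\nabla_\phi$ satisfies, as operators on $\Omega^*(\mathcal A,E)$, $$[\nabla_\phi,\nabla_\psi]=\nabla_{\nabla_\phi\psi}-(-1)^{kl}\nabla_{\nabla_\psi\phi}-i_{R(\phi,\psi)}.$$ -/

import Mathlib

open scoped Manifold ContDiff
open Bundle

noncomputable section

namespace LieAlgd

/-! ### Shuffles -/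

/-- The `(k, n - k)`-shuffles in the permutation group of `Fin n`: the permutations which are
increasing on the first `k` positions and increasing on the remaining ones. -/
def shuffles₂ (k n : ℕ) : Finset (Equiv.Perm (Fin n)) :=
  Finset.univ.filter fun σ => ∀ i j : Fin n, i < j →
    ((j : ℕ) < k ∨ k ≤ (i : ℕ)) → σ i < σ j

/-- The `(k, l, n - k - l)`-shuffles in the permutation group of `Fin n`. -/
def shuffles₃ (k l n : ℕ) : Finset (Equiv.Perm (Fin n)) :=
  Finset.univ.filter fun σ => ∀ i j : Fin n, i < j →
    ((j : ℕ) < k ∨ (k ≤ (i : ℕ) ∧ (j : ℕ) < k + l) ∨ k + l ≤ (i : ℕ)) → σ i < σ j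

/-! ### The formulas, for arbitrary modules

The next three definitions are the bare formulas for insertion, for the covariant exterior
derivative and for the form `R(φ, ψ)`; they are specialised to sections of vector bundles below. -/

section Formulas

variable {L N : Type*} [AddCommGroup N]

/-- `(i_φ ψ)(Z) = ∑_{σ ∈ Sh(k,m)} (-1)^σ ψ(φ(Z_σ(1), …, Z_σ(k)), Z_σ(k+1), …, Z_σ(k+m))`. -/
def insertFun {k m : ℕ} (φ : (Fin k → L) → L) (ψ : (Fin (m + 1) → L) → N)
    (Z : Fin (k + m) → L) : N :=
  ∑ σ ∈ shuffles₂ k (k + m), Equiv.Perm.sign σ •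
    ψ (Fin.cons (φ fun i => Z (σ (Fin.castAdd m i))) fun j => Z (σ (Fin.natAdd k j)))

/-- The second sum in the covariant exterior derivative,
`∑_{σ ∈ Sh(2,p-1)} (-1)^σ η([Z_σ(1), Z_σ(2)], Z_σ(3), …, Z_σ(p+1))`, an empty sum for `p = 0`. -/
def bracketSum (br : L → L → L) :
    {p : ℕ} → ((Fin p → L) → N) → (Fin (p + 1) → L) → N
  | 0, _, _ => 0
  | q + 1, η, Z => ∑ σ ∈ shuffles₂ 2 (q + 2), Equiv.Perm.sign σ •
      η (Fin.cons (br (Z (σ 0)) (Z (σ 1))) fun j => Z (σ j.succ.succ))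

/-- `(dη)(Z) = ∑_{σ ∈ Sh(1,p)} (-1)^σ ∇_{Z_σ(1)} (η(Z_σ(2), …, Z_σ(p+1)))
  - ∑_{σ ∈ Sh(2,p-1)} (-1)^σ η([Z_σ(1), Z_σ(2)], Z_σ(3), …, Z_σ(p+1))`. -/
def extDerivFun (nab : L → N → N) (br : L → L → L) {p : ℕ}
    (η : (Fin p → L) → N) (Z : Fin (p + 1) → L) : N :=
  (∑ σ ∈ shuffles₂ 1 (p + 1), Equiv.Perm.sign σ •
      nab (Z (σ 0)) (η fun j => Z (σ j.succ)))
    - bracketSum br η Z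

/-- `R(φ,ψ)(Y) = ∑_{σ ∈ Sh(k,l,1)} (-1)^σ
  R(φ(Y_σ(1), …, Y_σ(k)), ψ(Y_σ(k+1), …, Y_σ(k+l))) Y_σ(k+l+1)`. -/
def curvFun (R : N → N → N → N) {k l : ℕ} (φ : (Fin k → N) → N) (ψ : (Fin l → N) → N)
    (Y : Fin (k + l + 1) → N) : N :=
  ∑ σ ∈ shuffles₃ k l (k + l + 1), Equiv.Perm.sign σ •
    R (φ fun i => Y (σ (Fin.castAdd l i).castSucc))
      (ψ fun j => Y (σ (Fin.natAdd k j).castSucc)) (Y (σ (Fin.last (k + l))))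

end Formulas

/-! ### Helper facts: these formulas give alternating multilinear maps -/

section Helpers

theorem shuffle_sum_adj {L N : Type*} [AddCommGroup N] {n : ℕ} (same : Fin n → Fin n → Prop) [∀ i j, Decidable (same i j)]
    (G : (Fin n → L) → N)
    (hG : ∀ w i j, i < j → same i j → w i = w j → G w = 0)
    (v : Fin n → L) (t t' : Fin n) (htt : (t' : ℕ) = t + 1) (hv : v t = v t') :
    ∑ σ ∈ Finset.univ.filter (fun σ : Equiv.Perm (Fin n) =>
        ∀ i j : Fin n, i < j → same i j → σ i < σ j),
      Equiv.Perm.sign σ • G (fun i => v (σ i)) = 0 := by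
  classical
  have hne : t ≠ t' := by intro h; rw [h] at htt; omega
  have hvs : ∀ i, v (Equiv.swap t t' i) = v i := by
    intro i
    by_cases h1 : i = t
    · subst h1; rw [Equiv.swap_apply_left]; exact hv.symm
    by_cases h2 : i = t'
    · subst h2; rw [Equiv.swap_apply_right]; exact hv
    rw [Equiv.swap_apply_of_ne_of_ne h1 h2]
  have hneg : ∀ σ : Equiv.Perm (Fin n),
      Equiv.Perm.sign (Equiv.swap t t' * σ) • G (fun i => v ((Equiv.swap t t' * σ) i))
        = -(Equiv.Perm.sign σ • G (fun i => v (σ i))) := by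
    intro σ
    simp only [Equiv.Perm.mul_apply, hvs, Equiv.Perm.sign_mul, Equiv.Perm.sign_swap hne]
    simp [Units.smul_def]
  refine Finset.sum_involution (fun σ _ =>
    if G (fun i => v (σ i)) = 0 then σ else Equiv.swap t t' * σ) ?_ ?_ ?_ ?_
  · intro σ _
    by_cases h : G (fun i => v (σ i)) = 0
    · simp [h]
    · simp only [h, if_false]
      rw [hneg]; simp
  · intro σ _ h0
    have h : ¬ G (fun i => v (σ i)) = 0 := by
      intro h; exact h0 (by rw [h, smul_zero])
    simp only [h, if_false]
    intro h1
    have h2 : Equiv.swap t t' = 1 := by simpa using h1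
    exact hne (Equiv.swap_eq_one_iff.mp h2)
  · intro σ hσ
    by_cases h : G (fun i => v (σ i)) = 0
    · simpa [h] using hσ
    · simp only [h, if_false]
      simp only [Finset.mem_filter, Finset.mem_univ, true_and] at hσ ⊢
      intro i j hij hs
      have h1 := hσ i j hij hs
      have h2 : ¬ (σ i = t ∧ σ j = t') := by
        rintro ⟨ha, hb⟩
        exact h (hG _ i j hij hs (by rw [ha, hb, hv]))
      simp only [Equiv.Perm.mul_apply, Equiv.swap_apply_def]
      simp only [Fin.ext_iff, Fin.lt_def] at *
      split_ifs <;> omega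
  · intro σ _
    by_cases h : G (fun i => v (σ i)) = 0
    · simp [h]
    · simp only [h, if_false, Equiv.Perm.mul_apply, hvs]
      rw [← mul_assoc, Equiv.swap_mul_self, one_mul]

variable {L N : Type*} [AddCommGroup L] [AddCommGroup N]

/-- Additivity in each slot. -/
def SlotAdd {n : ℕ} (f : (Fin n → L) → N) : Prop :=
  ∀ (v : Fin n → L) (i : Fin n) (x y : L),
    f (Function.update v i (x + y)) = f (Function.update v i x) + f (Function.update v i y)

/-- Vanishing when two neighbouring entries agree. -/
def AdjZero {n : ℕ} (f : (Fin n → L) → N) : Prop :=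
  ∀ (v : Fin n → L) (t t' : Fin n), (t' : ℕ) = t + 1 → v t = v t' → f v = 0

theorem AdjZero.map_swap {n : ℕ} {f : (Fin n → L) → N} (ha : SlotAdd f) (hz : AdjZero f)
    (v : Fin n → L) (t t' : Fin n) (htt : (t' : ℕ) = t + 1) :
    f (fun i => v (Equiv.swap t t' i)) = - f v := by
  have hne : t ≠ t' := by intro h; rw [h] at htt; omega
  have key : ∀ x y : L, f (Function.update (Function.update v t x) t' y)
      + f (Function.update (Function.update v t y) t' x) = 0 := by
    intro x y
    have h0 := hz (Function.update (Function.update v t (x + y)) t' (x + y)) t t' htt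
      (by simp [hne])
    have hx := hz (Function.update (Function.update v t x) t' x) t t' htt (by simp [hne])
    have hy := hz (Function.update (Function.update v t y) t' y) t t' htt (by simp [hne])
    have e : ∀ z, f (Function.update (Function.update v t (x + y)) t' z)
        = f (Function.update (Function.update v t x) t' z)
          + f (Function.update (Function.update v t y) t' z) := by
      intro z
      have c : ∀ b : L, Function.update (Function.update v t b) t' z
          = Function.update (Function.update v t' z) t b :=
        fun b => Function.update_comm hne b z v
      rw [c, c, c, ha]
    rw [ha, e, e, hx, hy, zero_add, add_zero, add_comm] at h0
    exact h0
  have h := key (v t') (v t)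
  have e1 : Function.update (Function.update v t (v t')) t' (v t)
      = fun i => v (Equiv.swap t t' i) := by
    funext i
    by_cases h1 : i = t'
    · subst h1; simp
    by_cases h2 : i = t
    · subst h2; simp [hne]
    simp [h1, h2, Equiv.swap_apply_of_ne_of_ne h2 h1]
  have e2 : Function.update (Function.update v t (v t)) t' (v t') = v := by simp
  rw [e1, e2] at h
  exact eq_neg_of_add_eq_zero_left h

theorem AdjZero.map_perm {n : ℕ} {f : (Fin n → L) → N} (ha : SlotAdd f) (hz : AdjZero f)
    (σ : Equiv.Perm (Fin n)) :
    ∀ v : Fin n → L, f (fun i => v (σ i)) = Equiv.Perm.sign σ • f v := by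
  cases n with
  | zero =>
    intro v
    have : σ = 1 := Subsingleton.elim _ _
    subst this; simp
  | succ n =>
    have hσ : σ ∈ Submonoid.closure
        (Set.range fun i : Fin n ↦ Equiv.swap i.castSucc i.succ) := by
      rw [Equiv.Perm.mclosure_swap_castSucc_succ]; trivial
    induction hσ using Submonoid.closure_induction with
    | mem x hx =>
      obtain ⟨i, rfl⟩ := hx
      intro v
      have hne : i.castSucc ≠ i.succ := Fin.castSucc_lt_succ.ne
      rw [hz.map_swap ha v _ _ (by simp), Equiv.Perm.sign_swap hne]
      simp [Units.smul_def]
    | one => intro v; simp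
    | mul x y _ _ hx hy =>
      intro v
      have := hy (fun i => v (x i))
      simp only [Equiv.Perm.mul_apply]
      rw [this, hx, Equiv.Perm.sign_mul, smul_smul, mul_comm]

theorem AdjZero.alt {n : ℕ} {f : (Fin n → L) → N} (ha : SlotAdd f) (hz : AdjZero f)
    (v : Fin n → L) (i j : Fin n) (hv : v i = v j) (hij : i ≠ j) : f v = 0 := by
  wlog h : i < j generalizing i j
  · exact this j i hv.symm hij.symm (lt_of_le_of_ne (not_lt.mp h) hij.symm)
  have hn : (i : ℕ) + 1 < n := by have := j.2; simp only [Fin.lt_def] at h; omega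
  have h1 := hz.map_perm ha (Equiv.swap ⟨i + 1, hn⟩ j) v
  have h2 : f (fun a => v (Equiv.swap ⟨i + 1, hn⟩ j a)) = 0 := by
    refine hz _ i ⟨i + 1, hn⟩ rfl ?_
    rw [Equiv.swap_apply_left, Equiv.swap_apply_of_ne_of_ne _ hij, hv]
    simp [Fin.ext_iff]
  rw [h2] at h1
  exact (smul_eq_zero_iff_eq _).mp h1.symm

/-- An alternating map out of a function that is linear in each slot and vanishes when two
neighbouring entries agree. -/
def mkAlt {S : Type*} [CommRing S] [Module S L] [Module S N] {n : ℕ} (f : (Fin n → L) → N)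
    (ha : SlotAdd f)
    (hs : ∀ (v : Fin n → L) (i : Fin n) (c : S) (x : L),
      f (Function.update v i (c • x)) = c • f (Function.update v i x))
    (hz : AdjZero f) : L [⋀^Fin n]→ₗ[S] N where
  toFun := f
  map_update_add' := by
    intro inst v i x y
    have e : inst = instDecidableEqFin n := Subsingleton.elim _ _
    subst e; exact ha v i x y
  map_update_smul' := by
    intro inst v i c x
    have e : inst = instDecidableEqFin n := Subsingleton.elim _ _
    subst e; exact hs v i c x
  map_eq_zero_of_eq' v i j hv hij := hz.alt ha v i j hv hij

theorem update_perm {L : Type*} {n : ℕ} (v : Fin n → L) (σ : Equiv.Perm (Fin n)) (i : Fin n) (x : L) :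
    (fun j => Function.update v i x (σ j))
      = Function.update (fun j => v (σ j)) (σ.symm i) x := by
  funext j
  by_cases h : σ j = i
  · subst h; simp
  · have : j ≠ σ.symm i := by rintro rfl; simp at h
    simp [h, this]

theorem SlotAdd.shuffle {n : ℕ} {G : (Fin n → L) → N} (hG : SlotAdd G)
    (S : Finset (Equiv.Perm (Fin n))) :
    SlotAdd fun v => ∑ σ ∈ S, Equiv.Perm.sign σ • G (fun i => v (σ i)) := by
  intro v i x y
  simp only [update_perm, hG _ _ x y, smul_add, Finset.sum_add_distrib]

theorem slotSmul_shuffle {S : Type*} [CommRing S] [Module S L] [Module S N] {n : ℕ}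
    {G : (Fin n → L) → N}
    (hG : ∀ (v : Fin n → L) (i : Fin n) (c : S) (x : L),
      G (Function.update v i (c • x)) = c • G (Function.update v i x))
    (T : Finset (Equiv.Perm (Fin n))) (v : Fin n → L) (i : Fin n) (c : S) (x : L) :
    (∑ σ ∈ T, Equiv.Perm.sign σ • G (fun j => Function.update v i (c • x) (σ j)))
      = c • ∑ σ ∈ T, Equiv.Perm.sign σ • G (fun j => Function.update v i x (σ j)) := by
  simp only [update_perm, hG, Finset.smul_sum, Units.smul_def]
  exact Finset.sum_congr rfl fun σ _ => smul_comm _ _ _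


theorem cons_update_succ {L : Type*} {m : ℕ} (a : L) (w : Fin m → L) (j : Fin m) (x : L) :
    (Fin.cons a (Function.update w j x) : Fin (m + 1) → L)
      = Function.update (Fin.cons a w) j.succ x := by
  exact Fin.cons_update (α := fun _ => L) a w j x

theorem cons_eq_update {L : Type*} {m : ℕ} (a b : L) (w : Fin m → L) :
    (Fin.cons a w : Fin (m + 1) → L) = Function.update (Fin.cons b w) 0 a := by
  exact (Fin.update_cons_zero (α := fun _ => L) b w a).symm

section Insert

variable {S : Type*} [CommRing S] [Module S L] [Module S N]

theorem cons_add {m : ℕ} (ψ : L [⋀^Fin (m + 1)]→ₗ[S] N) (a b : L) (w : Fin m → L) :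
    ψ (Fin.cons (a + b) w) = ψ (Fin.cons a w) + ψ (Fin.cons b w) := by
  rw [cons_eq_update (a + b) 0, cons_eq_update a 0, cons_eq_update b 0, ψ.map_update_add]

theorem cons_smul {m : ℕ} (ψ : L [⋀^Fin (m + 1)]→ₗ[S] N) (c : S) (a : L) (w : Fin m → L) :
    ψ (Fin.cons (c • a) w) = c • ψ (Fin.cons a w) := by
  rw [cons_eq_update (c • a) 0, cons_eq_update a 0, ψ.map_update_smul]

theorem update_castAdd {L : Type*} {k m : ℕ} (v : Fin (k + m) → L) (i : Fin k) (x : L) :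
    ((fun a => Function.update v (Fin.castAdd m i) x (Fin.castAdd m a))
        = Function.update (fun a => v (Fin.castAdd m a)) i x) ∧
      ((fun b => Function.update v (Fin.castAdd m i) x (Fin.natAdd k b))
        = fun b => v (Fin.natAdd k b)) := by
  constructor
  · funext a
    by_cases h : a = i
    · subst h; simp
    · simp [h]
  · funext b
    have : Fin.natAdd k b ≠ Fin.castAdd m i := by
      have := i.2
      simp only [ne_eq, Fin.ext_iff, Fin.val_natAdd, Fin.val_castAdd]; omega
    simp [this]

theorem update_natAdd {L : Type*} {k m : ℕ} (v : Fin (k + m) → L) (i : Fin m) (x : L) :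
    ((fun a => Function.update v (Fin.natAdd k i) x (Fin.castAdd m a))
        = fun a => v (Fin.castAdd m a)) ∧
      ((fun b => Function.update v (Fin.natAdd k i) x (Fin.natAdd k b))
        = Function.update (fun b => v (Fin.natAdd k b)) i x) := by
  constructor
  · funext a
    have : Fin.castAdd m a ≠ Fin.natAdd k i := by
      have := a.2
      simp only [ne_eq, Fin.ext_iff, Fin.val_natAdd, Fin.val_castAdd]; omega
    simp [this]
  · funext b
    by_cases h : b = i
    · subst h; simp
    · simp [h]

variable {k m : ℕ} (φ : L [⋀^Fin k]→ₗ[S] L) (ψ : L [⋀^Fin (m + 1)]→ₗ[S] N)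

theorem insert_base_add : SlotAdd fun w : Fin (k + m) → L =>
    ψ (Fin.cons (φ fun i => w (Fin.castAdd m i)) fun j => w (Fin.natAdd k j)) := by
  intro v i x y
  refine Fin.addCases (fun i => ?_) (fun i => ?_) i
  · simp only [update_castAdd, φ.map_update_add, cons_add]
  · simp only [update_natAdd, cons_update_succ, ψ.map_update_add]

theorem insert_base_smul (v : Fin (k + m) → L) (i : Fin (k + m)) (c : S) (x : L) :
    (fun w : Fin (k + m) → L =>
      ψ (Fin.cons (φ fun i => w (Fin.castAdd m i)) fun j => w (Fin.natAdd k j)))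
        (Function.update v i (c • x))
    = c • (fun w : Fin (k + m) → L =>
      ψ (Fin.cons (φ fun i => w (Fin.castAdd m i)) fun j => w (Fin.natAdd k j)))
        (Function.update v i x) := by
  refine Fin.addCases (fun i => ?_) (fun i => ?_) i
  · simp only [update_castAdd, φ.map_update_smul, cons_smul]
  · simp only [update_natAdd, cons_update_succ, ψ.map_update_smul]

theorem insertFun_adj : AdjZero (insertFun (k := k) (m := m) φ ψ) := by
  intro v t t' htt hv
  refine shuffle_sum_adj (fun i j : Fin (k + m) => (j : ℕ) < k ∨ k ≤ (i : ℕ))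
    (fun w => ψ (Fin.cons (φ fun i => w (Fin.castAdd m i)) fun j => w (Fin.natAdd k j)))
    ?_ v t t' htt hv
  intro w i j hij hs hw
  have hij' : (i : ℕ) < j := hij
  rcases hs with hs | hs
  · have h0 : (φ fun i => w (Fin.castAdd m i)) = 0 :=
      φ.map_eq_zero_of_eq _ (i := ⟨i, by omega⟩) (j := ⟨j, hs⟩) hw (by simp [Fin.ext_iff]; omega)
    rw [h0]
    exact ψ.map_coord_zero 0 rfl
  · refine ψ.map_eq_zero_of_eq _ (i := Fin.succ ⟨i - k, by omega⟩)
      (j := Fin.succ ⟨j - k, by omega⟩) ?_ (by simp [Fin.ext_iff]; omega)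
    simp only [Fin.cons_succ]
    convert hw using 2 <;> (simp [Fin.ext_iff]; omega)

/-- Insertion of a vector-valued `k`-form, on forms of positive degree. -/
def insertForm : L [⋀^Fin (k + m)]→ₗ[S] N :=
  mkAlt (insertFun φ ψ) ((insert_base_add φ ψ).shuffle _)
    (slotSmul_shuffle (G := fun w : Fin (k + m) → L =>
      ψ (Fin.cons (φ fun i => w (Fin.castAdd m i)) fun j => w (Fin.natAdd k j)))
      (insert_base_smul φ ψ) (shuffles₂ k (k + m)))
    (insertFun_adj φ ψ)

theorem insertForm_apply (Z : Fin (k + m) → L) : insertForm φ ψ Z = insertFun φ ψ Z := rfl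

end Insert

section ExtDeriv

variable {S : Type*} [CommRing S] [Module S L] [Module S N]
  {nab : L → N → N} {br : L → L → L} {a : L → S → S}

theorem nab_sum_adj {p : ℕ} (η : L [⋀^Fin p]→ₗ[S] N) (nab0 : ∀ x, nab x 0 = 0) :
    AdjZero fun v : Fin (p + 1) → L => ∑ σ ∈ shuffles₂ 1 (p + 1), Equiv.Perm.sign σ •
      nab (v (σ 0)) (η fun j => v (σ j.succ)) := by
  intro v t t' htt hv
  refine shuffle_sum_adj (fun i j : Fin (p + 1) => (j : ℕ) < 1 ∨ 1 ≤ (i : ℕ))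
    (fun w => nab (w 0) (η fun j => w j.succ)) ?_ v t t' htt hv
  intro w i j hij hs hw
  have hij' : (i : ℕ) < j := hij
  have h0 : (η fun j => w j.succ) = 0 := by
    refine η.map_eq_zero_of_eq _ (i := ⟨i - 1, by omega⟩) (j := ⟨j - 1, by omega⟩) ?_
      (by simp [Fin.ext_iff]; omega)
    convert hw using 2 <;> (simp [Fin.ext_iff]; omega)
  simp only [h0, nab0]

theorem bracketSum_adj (br_self : ∀ x, br x x = 0) : ∀ {p : ℕ} (η : L [⋀^Fin p]→ₗ[S] N),
    AdjZero (bracketSum br (p := p) η)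
  | 0, _ => fun _ _ _ _ _ => rfl
  | q + 1, η => by
    intro v t t' htt hv
    refine shuffle_sum_adj (fun i j : Fin (q + 2) => (j : ℕ) < 2 ∨ 2 ≤ (i : ℕ))
      (fun w => η (Fin.cons (br (w 0) (w 1)) fun j => w j.succ.succ)) ?_ v t t' htt hv
    intro w i j hij hs hw
    have hij' : (i : ℕ) < j := hij
    rcases hs with hs | hs
    · have hi : i = 0 := Fin.ext (by rw [Fin.val_zero]; omega)
      have hj : j = 1 := Fin.ext (by rw [Fin.val_one]; omega)
      subst hi hj
      rw [hw, br_self]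
      exact η.map_coord_zero 0 rfl
    · refine η.map_eq_zero_of_eq _ (i := Fin.succ ⟨i - 2, by omega⟩)
        (j := Fin.succ ⟨j - 2, by omega⟩) ?_ (by simp [Fin.ext_iff]; omega)
      simp only [Fin.cons_succ]
      convert hw using 2 <;> (simp [Fin.ext_iff]; omega)

theorem nab_base_add (nab_add : ∀ x y s, nab (x + y) s = nab x s + nab y s)
    (nab_add' : ∀ x s t, nab x (s + t) = nab x s + nab x t) {p : ℕ} (η : L [⋀^Fin p]→ₗ[S] N) :
    SlotAdd fun w : Fin (p + 1) → L => nab (w 0) (η fun j => w j.succ) := by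
  intro v i x y
  refine Fin.cases ?_ (fun i => ?_) i
  · simp [nab_add]
  · have h : ∀ z, (fun j : Fin p => Function.update v i.succ z j.succ)
        = Function.update (fun j => v j.succ) i z := by
      intro z; funext j
      by_cases h : j = i
      · subst h; simp
      · simp [h]
    have h0 : ∀ z, Function.update v i.succ z 0 = v 0 := fun z =>
      Function.update_of_ne (Fin.succ_ne_zero i).symm _ _
    simp only [h, h0, η.map_update_add, nab_add']

theorem bracketSum_add (br_add : ∀ x y z, br (x + y) z = br x z + br y z)
    (br_add' : ∀ x y z, br x (y + z) = br x y + br x z) :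
    ∀ {p : ℕ} (η : L [⋀^Fin p]→ₗ[S] N), SlotAdd (bracketSum br (p := p) η)
  | 0, _ => fun _ _ _ _ => by simp [bracketSum]
  | q + 1, η => by
    refine SlotAdd.shuffle (G := fun w : Fin (q + 2) → L =>
      η (Fin.cons (br (w 0) (w 1)) fun j => w j.succ.succ)) ?_ _
    intro v i x y
    refine Fin.cases ?_ (fun i => ?_) i
    · simp [br_add, cons_add]
    · refine Fin.cases ?_ (fun i => ?_) i
      · have h : ∀ z, (fun j : Fin q => Function.update v (Fin.succ 0) z j.succ.succ)
            = fun j => v j.succ.succ := by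
          intro z; funext j
          exact Function.update_of_ne (by simp [Fin.ext_iff]) _ _
        simp only [h]
        have h1 : ∀ z, Function.update v (Fin.succ 0) z 1 = z := fun z =>
          Function.update_self _ _ _
        have h0 : ∀ z, Function.update v (Fin.succ 0) z 0 = v 0 := fun z =>
          Function.update_of_ne (Fin.succ_ne_zero _).symm _ _
        simp only [h1, h0, br_add', cons_add]
      · have h : ∀ z, (fun j : Fin q => Function.update v i.succ.succ z j.succ.succ)
            = Function.update (fun j => v j.succ.succ) i z := by
          intro z; funext j
          by_cases h : j = i
          · subst h; simp
          · simp [h]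
        have h1 : ∀ z, Function.update v i.succ.succ z 1 = v 1 := fun z =>
          Function.update_of_ne (by simp [Fin.ext_iff]) _ _
        have h0 : ∀ z, Function.update v i.succ.succ z 0 = v 0 := fun z =>
          Function.update_of_ne (Fin.succ_ne_zero _).symm _ _
        simp only [h, h1, h0, cons_update_succ, η.map_update_add]


theorem update_zero_of_ne {L : Type*} {n : ℕ} (v : Fin (n + 1) → L) (b c : L) (i : Fin (n + 1))
    (h : i ≠ 0) : Function.update v 0 b i = Function.update v 0 c i := by
  rw [Function.update_of_ne h, Function.update_of_ne h]

/-- If `0` is at position `i` of `v ∘ τ`, changing `v 0` changes entry `i` only. -/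
theorem update_zero_comp {L : Type*} {n p : ℕ} (v : Fin (n + 1) → L) (b c : L)
    (τ : Fin p → Fin (n + 1)) (hτ : Function.Injective τ) (i : Fin p) (h : τ i = 0) :
    (fun j => Function.update v 0 b (τ j))
      = Function.update (fun j => Function.update v 0 c (τ j)) i b := by
  funext j
  by_cases hj : j = i
  · subst hj; simp [h]
  · rw [Function.update_of_ne hj]
    exact update_zero_of_ne v b c _ fun h' => hj (hτ (h'.trans h.symm))

theorem alt_update_zero_smul {n p : ℕ} (η : L [⋀^Fin p]→ₗ[S] N) (v : Fin (n + 1) → L)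
    (c : S) (x : L) (τ : Fin p → Fin (n + 1)) (hτ : Function.Injective τ) (i : Fin p)
    (h : τ i = 0) :
    η (fun j => Function.update v 0 (c • x) (τ j))
      = c • η (fun j => Function.update v 0 x (τ j)) := by
  rw [update_zero_comp v (c • x) x τ hτ i h, η.map_update_smul,
    ← update_zero_comp v x x τ hτ i h]

theorem nab_sum_smul (nab_smul : ∀ (c : S) x s, nab (c • x) s = c • nab x s)
    (nab_leib : ∀ x (c : S) s, nab x (c • s) = c • nab x s + a x c • s)
    {p : ℕ} (η : L [⋀^Fin p]→ₗ[S] N) (v : Fin (p + 1) → L) (c : S) (x : L) :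
    (∑ σ ∈ shuffles₂ 1 (p + 1), Equiv.Perm.sign σ •
        nab (Function.update v 0 (c • x) (σ 0))
          (η fun j => Function.update v 0 (c • x) (σ j.succ)))
      = c • (∑ σ ∈ shuffles₂ 1 (p + 1), Equiv.Perm.sign σ •
          nab (Function.update v 0 x (σ 0)) (η fun j => Function.update v 0 x (σ j.succ)))
        + ∑ σ ∈ (shuffles₂ 1 (p + 1)).filter (fun σ => σ 0 ≠ 0), Equiv.Perm.sign σ •
            a (Function.update v 0 x (σ 0)) c • η fun j => Function.update v 0 x (σ j.succ) := by
  rw [Finset.sum_filter, Finset.smul_sum, ← Finset.sum_add_distrib]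
  refine Finset.sum_congr rfl fun σ _ => ?_
  by_cases h : σ 0 = 0
  · have h1 : ∀ j : Fin p, σ j.succ ≠ 0 := fun j hj =>
      Fin.succ_ne_zero j (σ.injective (hj.trans h.symm))
    have h2 : (fun j : Fin p => Function.update v 0 (c • x) (σ j.succ))
        = fun j => Function.update v 0 x (σ j.succ) :=
      funext fun j => update_zero_of_ne v _ _ _ (h1 j)
    rw [h2, if_neg (not_not.mpr h), add_zero, h, Function.update_self, Function.update_self,
      nab_smul]
    simp only [Units.smul_def]
    exact smul_comm _ _ _
  · obtain ⟨i, hi⟩ : ∃ i : Fin p, σ i.succ = 0 := by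
      obtain ⟨i, hi⟩ := Fin.exists_succ_eq.mpr
        (show σ.symm 0 ≠ 0 from fun h' => h (by rw [← h', Equiv.apply_symm_apply, h']))
      exact ⟨i, by rw [hi, Equiv.apply_symm_apply]⟩
    rw [if_pos h, alt_update_zero_smul η v c x (fun j => σ j.succ)
      (σ.injective.comp (Fin.succ_injective _)) i hi, nab_leib,
      update_zero_of_ne v (c • x) x _ h, smul_add]
    congr 1
    simp only [Units.smul_def]
    exact smul_comm _ _ _

theorem bracketSum_smul (br_smul : ∀ (c : S) x y, br (c • x) y = c • br x y - a y c • x)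
    {q : ℕ} (η : L [⋀^Fin (q + 1)]→ₗ[S] N) (v : Fin (q + 2) → L) (c : S) (x : L) :
    bracketSum br η (Function.update v 0 (c • x))
      = c • bracketSum br η (Function.update v 0 x)
        - ∑ σ ∈ (shuffles₂ 2 (q + 2)).filter (fun σ => σ 0 = 0), Equiv.Perm.sign σ •
            a (Function.update v 0 x (σ 1)) c •
              η (Fin.cons x fun j => Function.update v 0 x (σ j.succ.succ)) := by
  simp only [bracketSum]
  rw [Finset.sum_filter, Finset.smul_sum, ← Finset.sum_sub_distrib]
  refine Finset.sum_congr rfl fun σ hσ => ?_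
  simp only [shuffles₂, Finset.mem_filter, Finset.mem_univ, true_and] at hσ
  have h01 : σ 0 < σ 1 := hσ 0 1 (by simp) (Or.inl (by simp))
  have hne1 : σ 1 ≠ 0 := fun h => by rw [h] at h01; exact absurd h01 (by simp)
  by_cases h : σ 0 = 0
  · have h1 : ∀ j : Fin q, σ j.succ.succ ≠ 0 := fun j hj =>
      Fin.succ_ne_zero j.succ (σ.injective (hj.trans h.symm))
    have h2 : (fun j : Fin q => Function.update v 0 (c • x) (σ j.succ.succ))
        = fun j => Function.update v 0 x (σ j.succ.succ) :=
      funext fun j => update_zero_of_ne v _ _ _ (h1 j)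
    rw [h2, if_pos h, h, Function.update_self, Function.update_self,
      update_zero_of_ne v (c • x) x _ hne1, br_smul, sub_eq_add_neg, cons_add, cons_smul,
      ← neg_smul, cons_smul, neg_smul, smul_add, smul_neg, ← sub_eq_add_neg]
    congr 1
    simp only [Units.smul_def]
    exact smul_comm _ _ _
  · obtain ⟨i, hi⟩ : ∃ i : Fin q, σ i.succ.succ = 0 := by
      obtain ⟨i, hi⟩ := Fin.exists_succ_eq.mpr
        (show σ.symm 0 ≠ 0 from fun h' => h (by rw [← h', Equiv.apply_symm_apply, h']))
      have hi0 : i ≠ 0 := by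
        rintro rfl
        apply hne1
        have : (1 : Fin (q + 2)) = Fin.succ 0 := rfl
        rw [this, hi, Equiv.apply_symm_apply]
      obtain ⟨i', rfl⟩ := Fin.exists_succ_eq.mpr hi0
      exact ⟨i', by rw [hi, Equiv.apply_symm_apply]⟩
    have hinj : Function.Injective fun j : Fin q => σ j.succ.succ :=
      σ.injective.comp ((Fin.succ_injective _).comp (Fin.succ_injective _))
    rw [if_neg h, sub_zero, update_zero_of_ne v (c • x) x _ h,
      update_zero_of_ne v (c • x) x _ hne1,
      update_zero_comp v (c • x) x (fun j : Fin q => σ j.succ.succ) hinj i hi,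
      cons_update_succ, η.map_update_smul, ← cons_update_succ,
      ← update_zero_comp v x x (fun j : Fin q => σ j.succ.succ) hinj i hi]
    simp only [Units.smul_def]
    exact smul_comm _ _ _

theorem correction_cancel {q : ℕ} (η : L [⋀^Fin (q + 1)]→ₗ[S] N) (v : Fin (q + 2) → L)
    (b : L → S) :
    (∑ σ ∈ (shuffles₂ 1 (q + 2)).filter (fun σ => σ 0 ≠ 0), Equiv.Perm.sign σ •
        b (v (σ 0)) • η fun j => v (σ j.succ))
      = - ∑ σ ∈ (shuffles₂ 2 (q + 2)).filter (fun σ => σ 0 = 0), Equiv.Perm.sign σ •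
          b (v (σ 1)) • η (Fin.cons (v 0) fun j => v (σ j.succ.succ)) := by
  have hs1 : ∀ σ ∈ (shuffles₂ 1 (q + 2)).filter (fun σ => σ 0 ≠ 0), σ 1 = 0 := by
    intro σ hσ
    simp only [shuffles₂, Finset.mem_filter, Finset.mem_univ, true_and] at hσ
    obtain ⟨hσ, h0⟩ := hσ
    by_contra h1
    have hk0 : σ.symm 0 ≠ 0 := fun h' => h0 (by rw [← h', Equiv.apply_symm_apply, h'])
    have hk1 : σ.symm 0 ≠ 1 := fun h' => h1 (by rw [← h', Equiv.apply_symm_apply])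
    have hlt : (1 : Fin (q + 2)) < σ.symm 0 := by
      simp only [ne_eq, Fin.ext_iff, Fin.val_zero, Fin.val_one, Fin.lt_def] at *; omega
    have := hσ 1 _ hlt (Or.inr (by simp))
    rw [Equiv.apply_symm_apply] at this
    exact absurd this (by simp)
  have h01 : (0 : Fin (q + 2)) ≠ 1 := by simp
  have hss0 : ∀ j : Fin q, j.succ.succ ≠ (0 : Fin (q + 2)) := fun j => Fin.succ_ne_zero _
  have hss1 : ∀ j : Fin q, j.succ.succ ≠ (1 : Fin (q + 2)) := fun j => by simp [Fin.ext_iff]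
  rw [← Finset.sum_neg_distrib]
  refine Finset.sum_nbij' (fun σ => σ * Equiv.swap 0 1) (fun σ => σ * Equiv.swap 0 1)
    ?_ ?_ ?_ ?_ ?_
  · intro σ hσ
    have h10 := hs1 σ hσ
    simp only [shuffles₂, Finset.mem_filter, Finset.mem_univ, true_and] at hσ ⊢
    obtain ⟨hσ, h0⟩ := hσ
    refine ⟨fun i j hij hs => ?_, by simp [h10]⟩
    rcases hs with hs | hs
    · have hi : i = 0 := Fin.ext (by rw [Fin.val_zero]; simp only [Fin.lt_def] at hij; omega)
      have hj : j = 1 := Fin.ext (by rw [Fin.val_one]; simp only [Fin.lt_def] at hij; omega)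
      subst hi hj
      simpa [h10] using Fin.pos_iff_ne_zero.mpr h0
    · have hj : 2 ≤ (j : ℕ) := by simp only [Fin.lt_def] at hij; omega
      have ni0 : i ≠ 0 := by rintro rfl; simp at hs
      have ni1 : i ≠ 1 := by rintro rfl; simp at hs
      have nj0 : j ≠ 0 := by rintro rfl; simp at hj
      have nj1 : j ≠ 1 := by rintro rfl; simp at hj
      simp only [Equiv.Perm.mul_apply, Equiv.swap_apply_of_ne_of_ne ni0 ni1,
        Equiv.swap_apply_of_ne_of_ne nj0 nj1]
      exact hσ i j hij (Or.inr (by omega))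
  · intro σ hσ
    simp only [shuffles₂, Finset.mem_filter, Finset.mem_univ, true_and] at hσ ⊢
    obtain ⟨hσ, h0⟩ := hσ
    have h1 : σ 1 ≠ 0 := fun h => h01 (σ.injective (h0.trans h.symm))
    refine ⟨fun i j hij hs => ?_, by simpa using h1⟩
    have hi : 1 ≤ (i : ℕ) := by
      simp only [Fin.lt_def] at hij
      omega
    have nj0 : j ≠ 0 := by rintro rfl; simp at hij
    have nj1 : j ≠ 1 := by
      rintro rfl; simp only [Fin.lt_def, Fin.val_one] at hij; omega
    simp only [Equiv.Perm.mul_apply, Equiv.swap_apply_of_ne_of_ne nj0 nj1]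
    by_cases ni1 : i = 1
    · subst ni1
      rw [Equiv.swap_apply_right, h0]
      exact Fin.pos_iff_ne_zero.mpr fun h => nj0 (σ.injective (h.trans h0.symm))
    · have ni0 : i ≠ 0 := by rintro rfl; simp at hi
      rw [Equiv.swap_apply_of_ne_of_ne ni0 ni1]
      refine hσ i j hij (Or.inr ?_)
      simp only [Fin.ext_iff, Fin.val_one] at ni1; omega
  · intro σ _; simp [mul_assoc]
  · intro σ _; simp [mul_assoc]
  · intro σ hσ
    have h10 := hs1 σ hσ
    have e : (fun j : Fin (q + 1) => v (σ j.succ))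
        = Fin.cons (v 0) fun j : Fin q => v ((σ * Equiv.swap 0 1 : Equiv.Perm (Fin (q + 2))) j.succ.succ) := by
      funext j
      refine Fin.cases ?_ (fun j => ?_) j
      · rw [Fin.cons_zero, ← h10]; rfl
      · rw [Fin.cons_succ, Equiv.Perm.mul_apply,
          Equiv.swap_apply_of_ne_of_ne (hss0 j) (hss1 j)]
    rw [e, Equiv.Perm.sign_mul, Equiv.Perm.sign_swap h01]
    simp [Units.smul_def]

theorem extDerivFun_add (nab_add : ∀ x y s, nab (x + y) s = nab x s + nab y s)
    (nab_add' : ∀ x s t, nab x (s + t) = nab x s + nab x t)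
    (br_add : ∀ x y z, br (x + y) z = br x z + br y z)
    (br_add' : ∀ x y z, br x (y + z) = br x y + br x z)
    {p : ℕ} (η : L [⋀^Fin p]→ₗ[S] N) : SlotAdd (extDerivFun nab br (p := p) η) := by
  intro v i x y
  have h1 := (nab_base_add nab_add nab_add' η).shuffle (shuffles₂ 1 (p + 1)) v i x y
  have h2 := bracketSum_add br_add br_add' η v i x y
  simp only [extDerivFun]
  rw [h2]
  simp only at h1
  rw [h1]
  abel

theorem extDerivFun_adj (nab_add' : ∀ x s t, nab x (s + t) = nab x s + nab x t)
    (br_self : ∀ x, br x x = 0) {p : ℕ} (η : L [⋀^Fin p]→ₗ[S] N) :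
    AdjZero (extDerivFun nab br (p := p) η) := by
  intro v t t' htt hv
  have nab0 : ∀ x, nab x 0 = 0 := fun x => by simpa using nab_add' x 0 0
  have h1 := nab_sum_adj η nab0 v t t' htt hv
  have h2 := bracketSum_adj br_self η v t t' htt hv
  simp only [extDerivFun]
  rw [h2, sub_zero]
  exact h1

theorem extDerivFun_smul_zero
    (nab_smul : ∀ (c : S) x s, nab (c • x) s = c • nab x s)
    (nab_leib : ∀ x (c : S) s, nab x (c • s) = c • nab x s + a x c • s)
    (br_smul : ∀ (c : S) x y, br (c • x) y = c • br x y - a y c • x)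
    {p : ℕ} (η : L [⋀^Fin p]→ₗ[S] N) (v : Fin (p + 1) → L) (c : S) (x : L) :
    extDerivFun nab br η (Function.update v 0 (c • x))
      = c • extDerivFun nab br η (Function.update v 0 x) := by
  have h1 := nab_sum_smul nab_smul nab_leib η v c x
  cases p with
  | zero =>
    have hz : ∀ σ : Equiv.Perm (Fin 1), σ 0 = 0 := fun σ => Subsingleton.elim _ _
    simp only [extDerivFun, bracketSum, sub_zero]
    rw [h1, Finset.filter_false_of_mem, Finset.sum_empty, add_zero]
    intro σ _
    simpa using hz σ
  | succ q =>
    have h2 := bracketSum_smul (a := a) br_smul η v c x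
    have h3 := correction_cancel η (Function.update v 0 x) (fun y => a y c)
    simp only [Function.update_self] at h3
    simp only [extDerivFun]
    rw [h1, h2, h3, smul_sub]
    abel

theorem extDerivFun_smul (nab_add : ∀ x y s, nab (x + y) s = nab x s + nab y s)
    (nab_add' : ∀ x s t, nab x (s + t) = nab x s + nab x t)
    (nab_smul : ∀ (c : S) x s, nab (c • x) s = c • nab x s)
    (nab_leib : ∀ x (c : S) s, nab x (c • s) = c • nab x s + a x c • s)
    (br_add : ∀ x y z, br (x + y) z = br x z + br y z)
    (br_add' : ∀ x y z, br x (y + z) = br x y + br x z)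
    (br_self : ∀ x, br x x = 0)
    (br_smul : ∀ (c : S) x y, br (c • x) y = c • br x y - a y c • x)
    {p : ℕ} (η : L [⋀^Fin p]→ₗ[S] N) (v : Fin (p + 1) → L) (i : Fin (p + 1)) (c : S) (x : L) :
    extDerivFun nab br η (Function.update v i (c • x))
      = c • extDerivFun nab br η (Function.update v i x) := by
  have ha : SlotAdd (extDerivFun nab br (p := p) η) :=
    extDerivFun_add nab_add nab_add' br_add br_add' η
  have hz : AdjZero (extDerivFun nab br (p := p) η) := extDerivFun_adj nab_add' br_self η
  have key : ∀ z, extDerivFun nab br η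
      (Function.update (fun j => v (Equiv.swap 0 i j)) 0 z)
      = Equiv.Perm.sign (Equiv.swap 0 i) • extDerivFun nab br η (Function.update v i z) := by
    intro z
    rw [← hz.map_perm ha, update_perm]
    simp
  have h := extDerivFun_smul_zero nab_smul nab_leib br_smul η
    (fun j => v (Equiv.swap 0 i j)) c x
  rw [key, key, Units.smul_def, Units.smul_def, smul_comm, ← Units.smul_def,
    ← Units.smul_def] at h
  exact smul_left_cancel _ h

end ExtDeriv

section Curv

variable {S : Type*} [CommRing S] [Module S L] {R : L → L → L → L} {k l : ℕ}


variable (φ : L [⋀^Fin k]→ₗ[S] L) (ψ : L [⋀^Fin l]→ₗ[S] L)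

theorem update_castSucc {L : Type*} {n : ℕ} (v : Fin (n + 1) → L) (i : Fin n) (x : L) :
    ((fun a : Fin n => Function.update v i.castSucc x a.castSucc)
        = Function.update (fun a => v a.castSucc) i x) ∧
      Function.update v i.castSucc x (Fin.last n) = v (Fin.last n) := by
  constructor
  · funext a
    by_cases h : a = i
    · subst h; simp
    · simp [h]
  · exact Function.update_of_ne (Fin.castSucc_lt_last i).ne' _ _

/-- The summand of `curvFun` as a function of the permuted arguments. -/
def curvBase (R : L → L → L → L) (φ : L [⋀^Fin k]→ₗ[S] L) (ψ : L [⋀^Fin l]→ₗ[S] L)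
    (w : Fin (k + l + 1) → L) : L :=
  R (φ fun i => w (Fin.castAdd l i).castSucc) (ψ fun j => w (Fin.natAdd k j).castSucc)
    (w (Fin.last (k + l)))

theorem curvBase_last (v : Fin (k + l + 1) → L) (x : L) :
    curvBase R φ ψ (Function.update v (Fin.last (k + l)) x)
      = R (φ fun i => v (Fin.castAdd l i).castSucc) (ψ fun j => v (Fin.natAdd k j).castSucc)
        x := by
  have h : ∀ a : Fin (k + l), Function.update v (Fin.last (k + l)) x a.castSucc = v a.castSucc :=
    fun a => Function.update_of_ne (Fin.castSucc_lt_last a).ne _ _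
  simp only [curvBase, h, Function.update_self]

theorem curvBase_castAdd (v : Fin (k + l + 1) → L) (i : Fin k) (x : L) :
    curvBase R φ ψ (Function.update v (Fin.castAdd l i).castSucc x)
      = R (φ (Function.update (fun i => v (Fin.castAdd l i).castSucc) i x))
        (ψ fun j => v (Fin.natAdd k j).castSucc) (v (Fin.last (k + l))) := by
  have h := update_castSucc v (Fin.castAdd l i) x
  have h1 : ∀ a : Fin (k + l), Function.update v (Fin.castAdd l i).castSucc x a.castSucc
      = Function.update (fun a : Fin (k + l) => v a.castSucc) (Fin.castAdd l i) x a :=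
    fun a => congrFun h.1 a
  simp only [curvBase, h.2, h1]
  have h2 := update_castAdd (fun a => v a.castSucc) i x
  rw [h2.1, h2.2]

theorem curvBase_natAdd (v : Fin (k + l + 1) → L) (i : Fin l) (x : L) :
    curvBase R φ ψ (Function.update v (Fin.natAdd k i).castSucc x)
      = R (φ fun i => v (Fin.castAdd l i).castSucc)
        (ψ (Function.update (fun j => v (Fin.natAdd k j).castSucc) i x))
        (v (Fin.last (k + l))) := by
  have h := update_castSucc v (Fin.natAdd k i) x
  have h1 : ∀ a : Fin (k + l), Function.update v (Fin.natAdd k i).castSucc x a.castSucc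
      = Function.update (fun a : Fin (k + l) => v a.castSucc) (Fin.natAdd k i) x a :=
    fun a => congrFun h.1 a
  simp only [curvBase, h.2, h1]
  have h2 := update_natAdd (fun a => v a.castSucc) i x
  rw [h2.1, h2.2]

theorem curvBase_add
    (R_add₁ : ∀ x y z w, R (x + y) z w = R x z w + R y z w)
    (R_add₂ : ∀ x y z w, R x (y + z) w = R x y w + R x z w)
    (R_add₃ : ∀ x y z w, R x y (z + w) = R x y z + R x y w)
    : SlotAdd (curvBase R φ ψ) := by
  intro v i x y
  refine Fin.lastCases ?_ (fun i => ?_) i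
  · simp only [curvBase_last, R_add₃]
  · refine Fin.addCases (fun i => ?_) (fun i => ?_) i
    · simp only [curvBase_castAdd, φ.map_update_add, R_add₁]
    · simp only [curvBase_natAdd, ψ.map_update_add, R_add₂]

theorem curvBase_smul
    (R_smul₁ : ∀ (c : S) x y z, R (c • x) y z = c • R x y z)
    (R_smul₂ : ∀ (c : S) x y z, R x (c • y) z = c • R x y z)
    (R_smul₃ : ∀ (c : S) x y z, R x y (c • z) = c • R x y z)
    (v : Fin (k + l + 1) → L) (i : Fin (k + l + 1)) (c : S) (x : L) :
    curvBase R φ ψ (Function.update v i (c • x))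
      = c • curvBase R φ ψ (Function.update v i x) := by
  refine Fin.lastCases ?_ (fun i => ?_) i
  · simp only [curvBase_last, R_smul₃]
  · refine Fin.addCases (fun i => ?_) (fun i => ?_) i
    · simp only [curvBase_castAdd, φ.map_update_smul, R_smul₁]
    · simp only [curvBase_natAdd, ψ.map_update_smul, R_smul₂]

theorem curvFun_adj
    (R_smul₁ : ∀ (c : S) x y z, R (c • x) y z = c • R x y z)
    (R_smul₂ : ∀ (c : S) x y z, R x (c • y) z = c • R x y z)
    : AdjZero (curvFun R (k := k) (l := l) φ ψ) := by
  intro v t t' htt hv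
  refine shuffle_sum_adj (fun i j : Fin (k + l + 1) =>
      (j : ℕ) < k ∨ (k ≤ (i : ℕ) ∧ (j : ℕ) < k + l) ∨ k + l ≤ (i : ℕ))
    (curvBase R φ ψ) ?_ v t t' htt hv
  intro w i j hij hs hw
  have hij' : (i : ℕ) < j := hij
  rcases hs with hs | hs | hs
  · have h0 : (φ fun i => w (Fin.castAdd l i).castSucc) = 0 :=
      φ.map_eq_zero_of_eq _ (i := ⟨i, by omega⟩) (j := ⟨j, hs⟩) hw (by simp [Fin.ext_iff]; omega)
    rw [curvBase, h0]
    simpa using R_smul₁ 0 0 (ψ fun j => w (Fin.natAdd k j).castSucc) (w (Fin.last (k + l)))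
  · have h0 : (ψ fun j => w (Fin.natAdd k j).castSucc) = 0 := by
      refine ψ.map_eq_zero_of_eq _ (i := ⟨i - k, by omega⟩) (j := ⟨j - k, by omega⟩) ?_
        (by simp [Fin.ext_iff]; omega)
      convert hw using 2 <;> (simp [Fin.ext_iff]; omega)
    rw [curvBase, h0]
    simpa using R_smul₂ 0 (φ fun i => w (Fin.castAdd l i).castSucc) 0 (w (Fin.last (k + l)))
  · have := j.2
    omega

end Curv

end Helpers

/-! ### Lie algebroids over a manifold, connections, forms -/

section Geometry

variable {EM : Type*} [NormedAddCommGroup EM] [NormedSpace ℝ EM]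
  {H : Type*} [TopologicalSpace H] {I : ModelWithCorners ℝ EM H}
  {M : Type*} [TopologicalSpace M] [ChartedSpace H M]
  {F : Type*} [NormedAddCommGroup F] [NormedSpace ℝ F]
  {A : M → Type*} [TopologicalSpace (TotalSpace F A)] [∀ x, AddCommGroup (A x)]
  [∀ x, Module ℝ (A x)] [∀ x, TopologicalSpace (A x)] [FiberBundle F A] [VectorBundle ℝ F A]

/-- Multiplication of a smooth section by a smooth function. -/
instance instSMulSection : SMul C^∞⟮I, M; ℝ⟯ Cₛ^∞⟮I; F, A⟯ where
  smul f s := ⟨fun x => f x • s x, f.contMDiff.smul_section s.contMDiff⟩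

@[simp]
theorem smul_section_apply (f : C^∞⟮I, M; ℝ⟯) (s : Cₛ^∞⟮I; F, A⟯) (x : M) :
    (f • s) x = f x • s x := rfl

/-- `Γ(A)` is a module over `C^∞(M)`. -/
instance instModuleSection : Module C^∞⟮I, M; ℝ⟯ Cₛ^∞⟮I; F, A⟯ where
  one_smul s := by ext x; simp
  mul_smul f g s := by ext x; simp [mul_smul]
  smul_zero f := by ext x; simp
  smul_add f s t := by ext x; simp
  add_smul f g s := by ext x; simp [add_smul]
  zero_smul s := by ext x; simp

instance instSMulCommSection : SMulCommClass C^∞⟮I, M; ℝ⟯ ℝ Cₛ^∞⟮I; F, A⟯ where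
  smul_comm f c s := by ext x; exact smul_comm (f x) c (s x)

instance instTowerSection : IsScalarTower ℝ C^∞⟮I, M; ℝ⟯ Cₛ^∞⟮I; F, A⟯ where
  smul_assoc c f s := by ext x; exact smul_assoc c (f x) (s x)


variable (I F A) in
/-- An anchor: a smooth bundle map `ρ : A → TM` over the identity of `M`. -/
structure Anchor [IsManifold I ∞ M] where
  /-- the fibrewise linear maps `ρ_x : A_x → T_x M` -/
  anchor : ∀ x : M, A x →ₗ[ℝ] TangentSpace I x
  contMDiff_anchor : ContMDiff (I.prod 𝓘(ℝ, F)) I.tangent ∞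
    fun v : TotalSpace F A => (⟨v.proj, anchor v.proj v.snd⟩ : TangentBundle I M)

/-- The function `ρ(X) f`, that is `x ↦ df_x (ρ_x (X x))`. -/
def Anchor.deriv [IsManifold I ∞ M] (ρ : Anchor I F A) (X : Cₛ^∞⟮I; F, A⟯)
    (f : C^∞⟮I, M; ℝ⟯) : C^∞⟮I, M; ℝ⟯ :=
  ⟨fun x => mfderiv I 𝓘(ℝ, ℝ) f x (ρ.anchor x (X x)), by
    have h1 : ContMDiff I I.tangent ∞
        fun x => (⟨x, ρ.anchor x (X x)⟩ : TangentBundle I M) :=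
      ρ.contMDiff_anchor.comp X.contMDiff
    have h2 := (f.contMDiff.contMDiff_tangentMap (m := ∞) (by simp)).comp h1
    exact (contMDiff_snd_tangentBundle_modelSpace ℝ 𝓘(ℝ, ℝ)).comp h2⟩

variable (I F A) in
/-- A Lie algebroid structure on the vector bundle `A → M`: an anchor and a Lie bracket on the
smooth sections which satisfies the Leibniz rule. (That the anchor preserves brackets is a
consequence.) -/
structure LieAlgebroid [IsManifold I ∞ M] extends Anchor I F A where
  /-- the bracket of sections -/
  bracket : Cₛ^∞⟮I; F, A⟯ → Cₛ^∞⟮I; F, A⟯ → Cₛ^∞⟮I; F, A⟯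
  bracket_add : ∀ X Y Z, bracket X (Y + Z) = bracket X Y + bracket X Z
  bracket_smul : ∀ (c : ℝ) X Y, bracket X (c • Y) = c • bracket X Y
  bracket_skew : ∀ X Y, bracket X Y = -bracket Y X
  jacobi : ∀ X Y Z,
    bracket X (bracket Y Z) + bracket Y (bracket Z X) + bracket Z (bracket X Y) = 0
  leibniz : ∀ X (f : C^∞⟮I, M; ℝ⟯) Y,
    bracket X (f • Y) = f • bracket X Y + toAnchor.deriv X f • Y

variable [IsManifold I ∞ M]
  {FE : Type*} [NormedAddCommGroup FE] [NormedSpace ℝ FE]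
  {E : M → Type*} [TopologicalSpace (TotalSpace FE E)] [∀ x, AddCommGroup (E x)]
  [∀ x, Module ℝ (E x)] [∀ x, TopologicalSpace (E x)] [FiberBundle FE E] [VectorBundle ℝ FE E]

section Bracket

variable (𝒜 : LieAlgebroid I F A)

theorem LieAlgebroid.bracket_self (X : Cₛ^∞⟮I; F, A⟯) : 𝒜.bracket X X = 0 := by
  have h := 𝒜.bracket_skew X X
  have h2 : (2 : ℝ) • 𝒜.bracket X X = 0 := by
    rw [two_smul]; nth_rewrite 1 [h]; exact neg_add_cancel _
  exact (smul_eq_zero_iff_right (two_ne_zero' ℝ)).mp h2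

theorem LieAlgebroid.add_bracket (X Y Z : Cₛ^∞⟮I; F, A⟯) :
    𝒜.bracket (X + Y) Z = 𝒜.bracket X Z + 𝒜.bracket Y Z := by
  rw [𝒜.bracket_skew, 𝒜.bracket_add, 𝒜.bracket_skew Z X, 𝒜.bracket_skew Z Y]
  abel

theorem LieAlgebroid.smul_bracket (f : C^∞⟮I, M; ℝ⟯) (X Y : Cₛ^∞⟮I; F, A⟯) :
    𝒜.bracket (f • X) Y = f • 𝒜.bracket X Y - 𝒜.deriv Y f • X := by
  rw [𝒜.bracket_skew, 𝒜.leibniz, 𝒜.bracket_skew Y X, smul_neg]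
  abel

/-- The anchor preserves brackets, tested on `f • Z`. -/
theorem LieAlgebroid.deriv_bracket_smul (X Y Z : Cₛ^∞⟮I; F, A⟯) (f : C^∞⟮I, M; ℝ⟯) :
    𝒜.deriv (𝒜.bracket X Y) f • Z
      = 𝒜.deriv X (𝒜.deriv Y f) • Z - 𝒜.deriv Y (𝒜.deriv X f) • Z := by
  have J : ∀ W, 𝒜.bracket (𝒜.bracket X Y) W
      = 𝒜.bracket X (𝒜.bracket Y W) - 𝒜.bracket Y (𝒜.bracket X W) := by
    intro W
    have h := 𝒜.jacobi X Y W
    have hn : ∀ U V, 𝒜.bracket U (-V) = -𝒜.bracket U V := by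
      intro U V
      have := 𝒜.bracket_smul (-1) U V
      simpa using this
    rw [𝒜.bracket_skew W X, hn, 𝒜.bracket_skew W] at h
    rw [← sub_eq_zero, ← neg_eq_zero, ← h]
    abel
  have h := J (f • Z)
  simp only [𝒜.leibniz, 𝒜.bracket_add, J Z, smul_sub] at h
  have h' := sub_eq_zero.mpr h
  rw [← sub_eq_zero, ← h']
  abel

end Bracket

variable (FE E) in
/-- An `A`-connection on the vector bundle `E → M`. -/
structure Connection (𝒜 : LieAlgebroid I F A) where
  /-- the section `∇_X s` -/
  cov : Cₛ^∞⟮I; F, A⟯ → Cₛ^∞⟮I; FE, E⟯ → Cₛ^∞⟮I; FE, E⟯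
  cov_add : ∀ X s t, cov X (s + t) = cov X s + cov X t
  cov_smul : ∀ X (c : ℝ) s, cov X (c • s) = c • cov X s
  add_cov : ∀ X Y s, cov (X + Y) s = cov X s + cov Y s
  smul_cov : ∀ (f : C^∞⟮I, M; ℝ⟯) X s, cov (f • X) s = f • cov X s
  leibniz : ∀ X (f : C^∞⟮I, M; ℝ⟯) s, cov X (f • s) = 𝒜.deriv X f • s + f • cov X s

namespace Connection

variable {𝒜 : LieAlgebroid I F A}

/-- The curvature `R(X,Y)s = ∇_X ∇_Y s - ∇_Y ∇_X s - ∇_[X,Y] s`. -/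
def curvature (D : Connection FE E 𝒜) (X Y : Cₛ^∞⟮I; F, A⟯) (s : Cₛ^∞⟮I; FE, E⟯) :
    Cₛ^∞⟮I; FE, E⟯ :=
  D.cov X (D.cov Y s) - D.cov Y (D.cov X s) - D.cov (𝒜.bracket X Y) s

/-- A connection is flat (a representation of the Lie algebroid) if its curvature vanishes. -/
def IsFlat (D : Connection FE E 𝒜) : Prop := ∀ X Y s, D.curvature X Y s = 0

/-- An `A`-connection on `A` is torsion-free if `∇_X Y - ∇_Y X = [X,Y]`. -/
def IsTorsionFree (D : Connection F A 𝒜) : Prop :=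
  ∀ X Y, D.cov X Y - D.cov Y X = 𝒜.bracket X Y

theorem cov_sub (D : Connection FE E 𝒜) (X : Cₛ^∞⟮I; F, A⟯) (s t : Cₛ^∞⟮I; FE, E⟯) :
    D.cov X (s - t) = D.cov X s - D.cov X t := by
  have := D.cov_smul X (-1) t
  rw [sub_eq_add_neg, D.cov_add, sub_eq_add_neg]
  simpa using this

theorem sub_cov (D : Connection FE E 𝒜) (X Y : Cₛ^∞⟮I; F, A⟯) (s : Cₛ^∞⟮I; FE, E⟯) :
    D.cov (X - Y) s = D.cov X s - D.cov Y s := by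
  have := D.smul_cov (-1) Y s
  rw [sub_eq_add_neg, D.add_cov, sub_eq_add_neg]
  simpa using this

theorem curvature_skew (D : Connection FE E 𝒜) (X Y : Cₛ^∞⟮I; F, A⟯) (s : Cₛ^∞⟮I; FE, E⟯) :
    D.curvature X Y s = -D.curvature Y X s := by
  have h : D.cov (-𝒜.bracket Y X) s = -D.cov (𝒜.bracket Y X) s := by
    have := D.smul_cov (-1) (𝒜.bracket Y X) s
    simpa using this
  rw [curvature, curvature, 𝒜.bracket_skew X Y, h]
  abel

theorem curvature_add₁ (D : Connection FE E 𝒜) (X Y Z : Cₛ^∞⟮I; F, A⟯)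
    (s : Cₛ^∞⟮I; FE, E⟯) :
    D.curvature (X + Y) Z s = D.curvature X Z s + D.curvature Y Z s := by
  simp only [curvature, D.add_cov, D.cov_add, 𝒜.add_bracket]
  abel

theorem curvature_add₂ (D : Connection FE E 𝒜) (X Y Z : Cₛ^∞⟮I; F, A⟯)
    (s : Cₛ^∞⟮I; FE, E⟯) :
    D.curvature X (Y + Z) s = D.curvature X Y s + D.curvature X Z s := by
  simp only [curvature, D.add_cov, D.cov_add, 𝒜.bracket_add]
  abel

theorem curvature_add₃ (D : Connection FE E 𝒜) (X Y : Cₛ^∞⟮I; F, A⟯)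
    (s t : Cₛ^∞⟮I; FE, E⟯) :
    D.curvature X Y (s + t) = D.curvature X Y s + D.curvature X Y t := by
  simp only [curvature, D.cov_add]
  abel

theorem curvature_smul₁ (D : Connection FE E 𝒜) (f : C^∞⟮I, M; ℝ⟯) (X Y : Cₛ^∞⟮I; F, A⟯)
    (s : Cₛ^∞⟮I; FE, E⟯) : D.curvature (f • X) Y s = f • D.curvature X Y s := by
  simp only [curvature, D.smul_cov, D.leibniz, 𝒜.smul_bracket, D.sub_cov, smul_sub]
  abel

theorem curvature_smul₂ (D : Connection FE E 𝒜) (f : C^∞⟮I, M; ℝ⟯) (X Y : Cₛ^∞⟮I; F, A⟯)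
    (s : Cₛ^∞⟮I; FE, E⟯) : D.curvature X (f • Y) s = f • D.curvature X Y s := by
  rw [D.curvature_skew, D.curvature_smul₁, D.curvature_skew Y X, smul_neg, neg_neg]

theorem curvature_smul₃ (D : Connection F A 𝒜) (f : C^∞⟮I, M; ℝ⟯)
    (X Y Z : Cₛ^∞⟮I; F, A⟯) : D.curvature X Y (f • Z) = f • D.curvature X Y Z := by
  simp only [curvature, D.leibniz, D.cov_add, smul_sub, 𝒜.deriv_bracket_smul]
  abel

end Connection

variable (I F A FE E) in
/-- `Ω^k(A,E)`: the skew-symmetric `C^∞(M)`-multilinear maps `Γ(A)^k → Γ(E)`. -/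
abbrev Form (k : ℕ) :=
  Cₛ^∞⟮I; F, A⟯ [⋀^Fin k]→ₗ[C^∞⟮I, M; ℝ⟯] Cₛ^∞⟮I; FE, E⟯

variable (I F A FE E) in
/-- `Ω^*(A,E)`, the direct sum of the spaces `Ω^k(A,E)`. -/
abbrev Forms := DirectSum ℕ fun k => Form I F A FE E k

/-- Shortcut instance. -/
instance instAddCommGroupForms : AddCommGroup (Forms I F A FE E) := inferInstance

/-- Shortcut instance. -/
instance instModuleForms : Module ℝ (Forms I F A FE E) := inferInstance

/-- Shortcut instance. -/
instance instAddCommGroupEnd : AddCommGroup (Module.End ℝ (Forms I F A FE E)) := inferInstance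

/-- Shortcut instance. -/
instance instModuleEnd : Module ℝ (Module.End ℝ (Forms I F A FE E)) := inferInstance

/-- A `k`-form as an element of `Ω^*(A,E)`. -/
def homog (k : ℕ) : Form I F A FE E k →ₗ[ℝ] Forms I F A FE E :=
  DirectSum.lof ℝ ℕ (fun k => Form I F A FE E k) k

theorem real_smul_section (c : ℝ) (s : Cₛ^∞⟮I; F, A⟯) :
    c • s = (algebraMap ℝ C^∞⟮I, M; ℝ⟯ c) • s := (algebraMap_smul _ c s).symm

/-- `i_φ` for `φ ∈ Ω^k(A,A)`, from `Ω^{m+1}(A,E)` to `Ω^{k+m}(A,E)`; linear in `φ`. -/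
def insertHom (k m : ℕ) :
    Form I F A F A k →ₗ[ℝ] Form I F A FE E (m + 1) →ₗ[ℝ] Form I F A FE E (k + m) :=
  LinearMap.mk₂ ℝ (fun φ ψ => insertForm φ ψ)
    (by
      intro φ φ' ψ; ext1 v
      simp only [AlternatingMap.add_apply, insertForm_apply, insertFun, cons_add, smul_add,
        Finset.sum_add_distrib])
    (by
      intro c φ ψ; ext1 v
      simp only [AlternatingMap.smul_apply, insertForm_apply, insertFun, Finset.smul_sum]
      refine Finset.sum_congr rfl fun σ _ => ?_
      rw [real_smul_section, cons_smul, ← real_smul_section]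
      simp only [Units.smul_def]
      exact smul_comm _ _ _)
    (by
      intro φ ψ ψ'; ext1 v
      simp only [AlternatingMap.add_apply, insertForm_apply, insertFun, smul_add,
        Finset.sum_add_distrib])
    (by
      intro c φ ψ; ext1 v
      simp only [AlternatingMap.smul_apply, insertForm_apply, insertFun, Finset.smul_sum,
        Units.smul_def]
      exact Finset.sum_congr rfl fun σ _ => smul_comm _ _ _)

variable {𝒜 : LieAlgebroid I F A}

/-- The covariant exterior derivative of a form. -/
def extDerivForm (D : Connection FE E 𝒜) {p : ℕ} (η : Form I F A FE E p) :
    Form I F A FE E (p + 1) :=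
  mkAlt (extDerivFun D.cov 𝒜.bracket η)
    (extDerivFun_add D.add_cov D.cov_add 𝒜.add_bracket 𝒜.bracket_add η)
    (extDerivFun_smul (a := 𝒜.deriv) D.add_cov D.cov_add D.smul_cov
      (fun X f s => (D.leibniz X f s).trans (add_comm _ _)) 𝒜.add_bracket 𝒜.bracket_add
      𝒜.bracket_self 𝒜.smul_bracket η)
    (extDerivFun_adj D.cov_add 𝒜.bracket_self η)

theorem extDerivForm_apply (D : Connection FE E 𝒜) {p : ℕ} (η : Form I F A FE E p)
    (Z : Fin (p + 1) → Cₛ^∞⟮I; F, A⟯) :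
    extDerivForm D η Z = extDerivFun D.cov 𝒜.bracket η Z := rfl

theorem bracketSum_linear (br : Cₛ^∞⟮I; F, A⟯ → Cₛ^∞⟮I; F, A⟯ → Cₛ^∞⟮I; F, A⟯) :
    ∀ {p : ℕ} (c : ℝ) (η θ : Form I F A FE E p) (Z : Fin (p + 1) → Cₛ^∞⟮I; F, A⟯),
      bracketSum br (⇑(c • η + θ)) Z = c • bracketSum br η Z + bracketSum br θ Z
  | 0, _, _, _, _ => by simp [bracketSum]
  | q + 1, c, η, θ, Z => by
    simp only [bracketSum, AlternatingMap.add_apply, AlternatingMap.smul_apply, smul_add,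
      Finset.sum_add_distrib, Finset.smul_sum, Units.smul_def]
    congr 1
    exact Finset.sum_congr rfl fun σ _ => smul_comm _ _ _

theorem extDerivForm_linear (D : Connection FE E 𝒜) {p : ℕ} (c : ℝ)
    (η θ : Form I F A FE E p) :
    extDerivForm D (c • η + θ) = c • extDerivForm D η + extDerivForm D θ := by
  ext1 v
  simp only [AlternatingMap.add_apply, AlternatingMap.smul_apply, extDerivForm_apply]
  simp only [extDerivFun, bracketSum_linear]
  simp only [AlternatingMap.add_apply, AlternatingMap.smul_apply, D.cov_add, D.cov_smul,
    smul_add, Finset.sum_add_distrib, smul_sub, Finset.smul_sum, Units.smul_def]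
  rw [Finset.sum_congr rfl fun σ _ => smul_comm _ c _]
  abel

/-- The covariant exterior derivative `d^∇` from `Ω^p(A,E)` to `Ω^{p+1}(A,E)`. -/
def extDerivHom (D : Connection FE E 𝒜) (p : ℕ) :
    Form I F A FE E p →ₗ[ℝ] Form I F A FE E (p + 1) where
  toFun η := extDerivForm D η
  map_add' η θ := by simpa using extDerivForm_linear D 1 η θ
  map_smul' c η := by
    have h0 : extDerivForm D (0 : Form I F A FE E p) = 0 := by
      simpa using extDerivForm_linear D (-1) 0 (0 : Form I F A FE E p)
    simpa [h0] using extDerivForm_linear D c η 0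

/-- The form `R(φ,ψ) ∈ Ω^{k+l+1}(A,A)` built from the curvature of an `A`-connection on `A`. -/
def curvForm (D : Connection F A 𝒜) {k l : ℕ} (φ : Form I F A F A k) (ψ : Form I F A F A l) :
    Form I F A F A (k + l + 1) :=
  mkAlt (curvFun D.curvature φ ψ)
    ((curvBase_add φ ψ D.curvature_add₁ D.curvature_add₂ D.curvature_add₃).shuffle _)
    (slotSmul_shuffle (G := curvBase D.curvature φ ψ)
      (curvBase_smul φ ψ D.curvature_smul₁ D.curvature_smul₂ D.curvature_smul₃)
      (shuffles₃ k l (k + l + 1)))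
    (curvFun_adj φ ψ D.curvature_smul₁ D.curvature_smul₂)

theorem curvForm_apply (D : Connection F A 𝒜) {k l : ℕ} (φ : Form I F A F A k)
    (ψ : Form I F A F A l) (Y : Fin (k + l + 1) → Cₛ^∞⟮I; F, A⟯) :
    curvForm D φ ψ Y = curvFun D.curvature φ ψ Y := rfl

/-! ### The operators on `Ω^*(A,E)` -/

/-- `i_φ` on homogeneous forms: zero on `Ω^0(A,E)`. -/
def insertOn (k : ℕ) :
    (m : ℕ) → Form I F A F A k →ₗ[ℝ] Form I F A FE E m →ₗ[ℝ] Forms I F A FE E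
  | 0 => 0
  | m + 1 => (insertHom k m).compr₂ (homog (k + m))

/-- `i_φ` for `φ ∈ Ω^k(A,A)`, as an endomorphism of `Ω^*(A,E)`; linear in `φ`. -/
def interior (k : ℕ) : Form I F A F A k →ₗ[ℝ] Module.End ℝ (Forms I F A FE E) where
  toFun φ := DirectSum.toModule ℝ ℕ _ fun m => insertOn k m φ
  map_add' φ φ' := by
    refine DirectSum.linearMap_ext ℝ fun m => ?_
    ext1 η
    simp
  map_smul' c φ := by
    refine DirectSum.linearMap_ext ℝ fun m => ?_
    ext1 η
    simp

/-- The covariant exterior derivative `d^∇` as an endomorphism of `Ω^*(A,E)`. -/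
def extDeriv (D : Connection FE E 𝒜) : Module.End ℝ (Forms I F A FE E) :=
  DirectSum.toModule ℝ ℕ _ fun p => homog (p + 1) ∘ₗ extDerivHom D p

/-- The covariant Lie derivative `𝓛^∇_φ = i_φ d^∇ + (-1)^k d^∇ i_φ` for `φ ∈ Ω^k(A,A)`. -/
def lieDeriv (D : Connection FE E 𝒜) (k : ℕ) :
    Form I F A F A k →ₗ[ℝ] Module.End ℝ (Forms I F A FE E) where
  toFun φ := interior k φ * extDeriv D + (-1 : ℝ) ^ k • (extDeriv D * interior k φ)
  map_add' φ φ' := by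
    simp only [map_add, add_mul, mul_add, smul_add]; abel
  map_smul' c φ := by
    simp only [map_smul, smul_mul_assoc, mul_smul_comm, smul_add, RingHom.id_apply]
    rw [smul_comm c]

/-- `∇_φ = 𝓛^∇_φ - (-1)^k i_{d^∇ φ}` on `Ω^*(A,E)` for `φ ∈ Ω^k(A,A)`, where `D` is the connection
on `E` (used in `𝓛^∇_φ`) and `DA` the connection on `A` (used in `d^∇ φ`); linear in `φ`. -/
def nablaHom (DA : Connection F A 𝒜) (D : Connection FE E 𝒜) (k : ℕ) :
    Form I F A F A k →ₗ[ℝ] Module.End ℝ (Forms I F A FE E) where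
  toFun φ := lieDeriv D k φ - (-1 : ℝ) ^ k • interior (k + 1) (extDerivHom DA k φ)
  map_add' φ φ' := by
    simp only [map_add, smul_add]; abel
  map_smul' c φ := by
    simp only [map_smul, RingHom.id_apply, smul_sub]
    rw [smul_comm c]

/-- `Φ ↦ ∇_Φ`, extended linearly to all `Φ ∈ Ω^*(A,A)`. -/
def nabla (DA : Connection F A 𝒜) (D : Connection FE E 𝒜) :
    Forms I F A F A →ₗ[ℝ] Module.End ℝ (Forms I F A FE E) :=
  DirectSum.toModule ℝ ℕ _ (nablaHom DA D)

/-- The graded commutator of operators of degrees `k` and `l`. -/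
def gradedCommutator {W : Type*} [AddCommGroup W] [Module ℝ W] (k l : ℕ)
    (P Q : Module.End ℝ W) : Module.End ℝ W :=
  P * Q - (-1 : ℝ) ^ (k * l) • (Q * P)

end Geometry
end LieAlgd
end

noncomputable section

namespace LieAlgd

set_option linter.unusedSectionVars false


/-! ### Forms as functions on lists -/

section ListForms

variable {L N : Type*} [AddCommGroup L] [Module ℝ L] [AddCommGroup N] [Module ℝ N]

/-! For `φ = α ⊗ X`, torsion-freeness turns the definition of `∇_φ` into `∇_φ ω = α ∧ ∇_X ω`. So
`∇_φ` differentiates only along the values of `φ`, and a commutator of two such operators consists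
of derivatives of one field along the other, plus curvature. The curvature of `E` is zero; that of
`A` acts on the arguments of `ω` and gives `i_{R(φ,ψ)}`.

The argument avoids decomposable forms. Two forms agree if they agree on the empty list of arguments
and all their contractions `ι_Z` agree. The operators obey `ι_Z i_φ = i_{ι_Z φ} - (-1)^k i_φ ι_Z`,
`ι_Z ∇_φ = ∇_{ι_Z φ} + (-1)^k ∇_φ ι_Z - (-1)^k i_{∇_φ Z}`, where `∇_φ Z` is the form `l ↦ ∇_{φ(l)}
Z` (`covAlong`). On functions of a list of arguments these rules serve as recursive definitions
(`listInsert`, `listNabla`), and every commutator formula is an induction on the length of the list.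

Three commutators build on each other: `[i_φ, i_ψ]` (`listInsert_listInsert`), `[∇_φ, i_ψ]`
(`listNabla_listInsert`), and `[∇_φ, ∇_ψ]` (`listNabla_listNabla`). Contracting one with `Z`
produces its own instances for `ι_Z φ`, `ι_Z ψ`, `ι_Z f`, and instances of the preceding one caused
by the term `i_{∇_φ Z}`. In the last of the three, what is left over is the Ricci identity
`listNabla_covAlong`. The base case is flatness.

Two bridges lead back to the theorem. `listNabla_eq` identifies the recursive `∇_φ` with `i_φ d +
(-1)^k d i_φ - (-1)^k i_{dφ}`, using the torsion-free bracket. The recursion `shuffleSum_cons`, by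
the position of the first argument in a shuffle, identifies the shuffle sums for `i_φ`, `d` and
`R(φ,ψ)` with their recursive versions. -/

/-- Contraction of a function on lists with `Z`. -/
def contr {L N : Type*} (Z : L) (f : List L → N) : List L → N := fun l => f (Z :: l)

@[simp]
theorem contr_apply {L N : Type*} (Z : L) (f : List L → N) (l : List L) :
    contr Z f l = f (Z :: l) := rfl

@[simp]
theorem contr_add (Z : L) (f g : List L → N) : contr Z (f + g) = contr Z f + contr Z g := rfl

@[simp]
theorem contr_smul (c : ℝ) (Z : L) (f : List L → N) : contr Z (c • f) = c • contr Z f := rfl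

/-- Linearity in the last entry. -/
structure LastLinear (f : List L → N) : Prop where
  add : ∀ l x y, f (l ++ [x + y]) = f (l ++ [x]) + f (l ++ [y])
  smul : ∀ l (c : ℝ) x, f (l ++ [c • x]) = c • f (l ++ [x])

/-- The arbitrary prefix in `LastLinear` is what makes it stable under contraction. Linearity in the
last entry suffices for the inductions, and it is asked of `f` alone, never of `φ` or `ψ`. -/
theorem LastLinear.contr {f : List L → N} (hf : LastLinear f) (Z : L) :
    LastLinear (contr Z f) :=
  ⟨fun l x y => hf.add (Z :: l) x y, fun l c x => hf.smul (Z :: l) c x⟩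

theorem LastLinear.single_add {f : List L → N} (hf : LastLinear f) (x y : L) :
    f [x + y] = f [x] + f [y] := hf.add [] x y

theorem LastLinear.single_smul {f : List L → N} (hf : LastLinear f) (c : ℝ) (x : L) :
    f [c • x] = c • f [x] := hf.smul [] c x

theorem LastLinear.single_zero {f : List L → N} (hf : LastLinear f) : f [0] = 0 := by
  simpa using hf.single_smul 0 0

theorem LastLinear.single_sub {f : List L → N} (hf : LastLinear f) (x y : L) :
    f [x - y] = f [x] - f [y] := by
  have := hf.single_smul (-1) y
  rw [sub_eq_add_neg, hf.single_add, sub_eq_add_neg]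
  simpa using this

/-- The vanishing of `φ` on lists whose length does not have the parity of `p`. -/
def HasParity (p : ℕ) (φ : List L → N) : Prop := ∀ l, ¬ Even (l.length + p) → φ l = 0

/-- Contraction lowers the degree by one. Since signs depend only on parity, `p + 1` can stand for
`p - 1`, and no truncated subtraction occurs. -/
theorem HasParity.contr {p : ℕ} {φ : List L → N} (h : HasParity p φ) (Z : L) :
    HasParity (p + 1) (contr Z φ) := by
  intro l hl
  refine h (Z :: l) ?_
  rwa [List.length_cons, add_assoc, add_comm 1 p]

theorem HasParity.nil_eq_zero {p : ℕ} {φ : List L → N} (h : HasParity p φ) (hp : Odd p) :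
    φ [] = 0 := h [] (by simpa using hp)

/-- Antisymmetry in the last two entries. -/
def LastAlt (f : List L → N) : Prop := ∀ l x y, f (l ++ [x, y]) = - f (l ++ [y, x])

theorem LastAlt.contr {f : List L → N} (hf : LastAlt f) (Z : L) : LastAlt (contr Z f) :=
  fun l x y => hf (Z :: l) x y

/-- Insertion `i_φ` for functions on lists, where `φ` has the parity of `p`. -/
def listInsert : ℕ → (List L → L) → (List L → N) → List L → N
  | _, φ, f, [] => f [φ []]
  | p, φ, f, Z :: l =>
    listInsert (p + 1) (contr Z φ) f l - (-1 : ℝ) ^ p • listInsert p φ (contr Z f) l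

theorem listInsert_nil (p : ℕ) (φ : List L → L) (f : List L → N) :
    listInsert p φ f [] = f [φ []] := rfl

theorem contr_listInsert (p : ℕ) (φ : List L → L) (f : List L → N) (Z : L) :
    contr Z (listInsert p φ f) = listInsert (p + 1) (contr Z φ) f
      - (-1 : ℝ) ^ p • listInsert p φ (contr Z f) := rfl

theorem listInsert_cons (p : ℕ) (φ : List L → L) (f : List L → N) (Z : L) (l : List L) :
    listInsert p φ f (Z :: l) = listInsert (p + 1) (contr Z φ) f l
      - (-1 : ℝ) ^ p • listInsert p φ (contr Z f) l := rfl

theorem listInsert_add_right (p : ℕ) (φ : List L → L) (f g : List L → N) :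
    listInsert p φ (f + g) = listInsert p φ f + listInsert p φ g := by
  funext l
  induction l generalizing p φ f g with
  | nil => rfl
  | cons Z l ih =>
    simp only [listInsert_cons, contr_add, ih, Pi.add_apply]; module

theorem listInsert_smul_right (p : ℕ) (φ : List L → L) (c : ℝ) (f : List L → N) :
    listInsert p φ (c • f) = c • listInsert p φ f := by
  funext l
  induction l generalizing p φ f with
  | nil => rfl
  | cons Z l ih =>
    simp only [listInsert_cons, contr_smul, ih, Pi.smul_apply]; module

theorem listInsert_sub_right (p : ℕ) (φ : List L → L) (f g : List L → N) :
    listInsert p φ (f - g) = listInsert p φ f - listInsert p φ g := by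
  have h : f - g = f + (-1 : ℝ) • g := by module
  rw [h, listInsert_add_right, listInsert_smul_right]; module

/-- When the list is exhausted, the value of `φ` is the last entry handed to a contraction of `f`;
hence the hypothesis on `f`, which additivity in `f` does not need. -/
theorem listInsert_add_left (p : ℕ) (φ χ : List L → L) {f : List L → N} (hf : LastLinear f) :
    listInsert p (φ + χ) f = listInsert p φ f + listInsert p χ f := by
  funext l
  induction l generalizing p φ χ f with
  | nil => exact hf.single_add _ _
  | cons Z l ih =>
    simp only [listInsert_cons, contr_add, ih _ _ _ hf, ih _ _ _ (hf.contr Z), Pi.add_apply]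
    module

theorem listInsert_smul_left (p : ℕ) (c : ℝ) (φ : List L → L) {f : List L → N}
    (hf : LastLinear f) : listInsert p (c • φ) f = c • listInsert p φ f := by
  funext l
  induction l generalizing p φ f with
  | nil => exact hf.single_smul _ _
  | cons Z l ih =>
    simp only [listInsert_cons, contr_smul, ih _ _ hf, ih _ _ (hf.contr Z), Pi.smul_apply]
    module

theorem listInsert_sub_left (p : ℕ) (φ χ : List L → L) {f : List L → N} (hf : LastLinear f) :
    listInsert p (φ - χ) f = listInsert p φ f - listInsert p χ f := by
  have h : φ - χ = φ + (-1 : ℝ) • χ := by module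
  rw [h, listInsert_add_left _ _ _ hf, listInsert_smul_left _ _ _ hf]; module

/-- Insertion acts on arguments only, so it commutes with a linear map on values. The case of
interest is `T = ∇_{(·)} Z`, in `covAlong_listInsert`. -/
theorem listInsert_comp (p : ℕ) (φ : List L → L) (T : N →ₗ[ℝ] N) (f : List L → N) :
    listInsert p φ (T ∘ f) = T ∘ listInsert p φ f := by
  funext l
  induction l generalizing p φ f with
  | nil => rfl
  | cons Z l ih =>
    have h : contr Z (T ∘ f) = T ∘ contr Z f := rfl
    simp only [listInsert_cons, h, ih, Function.comp_apply, map_sub, map_smul]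

/-- The index enters only through `(-1) ^ p`. This reconciles indices such as `p + q + 2` and `p +
q`. -/
theorem listInsert_congr_parity {p q : ℕ} (h : Even (p + q)) (φ : List L → L)
    (f : List L → N) : listInsert p φ f = listInsert q φ f := by
  funext l
  induction l generalizing p q φ f with
  | nil => rfl
  | cons Z l ih =>
    have h' : Even (p + 1 + (q + 1)) := by grind
    have hs : (-1 : ℝ) ^ p = (-1) ^ q := by
      rcases Nat.even_or_odd p with hp | hp
      · rw [hp.neg_one_pow, ((Nat.even_add.mp h).mp hp).neg_one_pow]
      · have hq : Odd q := by grind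
        rw [hp.neg_one_pow, hq.neg_one_pow]
    simp only [listInsert_cons, ih h', ih h, hs]

/-- The commutator of two insertions. -/
theorem listInsert_listInsert {p q r : ℕ} (hr : r = p + q + 1) {s : ℝ}
    (hs : s = (-1) ^ ((p + 1) * (q + 1))) {φ ψ : List L → L} (hφ : HasParity p φ)
    (hψ : HasParity q ψ) {f : List L → N} (hf : LastLinear f) (ha : LastAlt f) :
    listInsert p φ (listInsert q ψ f) - s • listInsert q ψ (listInsert p φ f)
      = listInsert r (listInsert p φ ψ) f - s • listInsert r (listInsert q ψ φ) f := by
  funext l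
  -- The index `r`, which is `p + q - 1` up to parity, and the sign `s` are variables tied by
  -- equations, so that the induction hypothesis applies to shifted exponents.
  induction l generalizing p q r s φ ψ f with
  | nil =>
    simp only [Pi.sub_apply, Pi.smul_apply, listInsert_nil, listInsert_cons, contr_apply]
    have h2 := ha [] (φ []) (ψ [])
    simp only [List.nil_append] at h2
    -- If both parities are even, the surviving terms cancel by antisymmetry of `f` in `φ []` and `ψ
    -- []`. An odd parity makes one of these values zero.
    rcases Nat.even_or_odd p with hp | hp
    · rcases Nat.even_or_odd q with hq | hq
      · have : s = -1 := by
          rw [hs]; exact (hp.add_one.mul hq.add_one).neg_one_pow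
        rw [this, hp.neg_one_pow, hq.neg_one_pow, h2]
        module
      · have h0 := hψ.nil_eq_zero hq
        rw [h0] at h2
        have h3 := (hf.contr (φ [])).single_zero
        simp only [contr_apply] at h3
        rw [h3] at h2
        rw [h0, h3, ← neg_eq_iff_eq_neg.mpr h2]
        module
    · have h0 := hφ.nil_eq_zero hp
      rw [h0] at h2
      have h3 := (hf.contr (ψ [])).single_zero
      simp only [contr_apply] at h3
      rw [h3] at h2
      rw [h0, h3, h2]
      module
  | cons Z l ih =>
    -- Raising `p` by one multiplies `(-1) ^ ((p + 1) * (q + 1))` by `(-1) ^ (q + 1)`, and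
    -- symmetrically for `q`; contracting `f` leaves the sign alone.
    have i1 := ih (r := r + 1) (s := -(-1) ^ q * s) (by omega) (by rw [hs]; ring)
      (hφ.contr Z) hψ hf ha
    have i2 := ih (r := r + 1) (s := -(-1) ^ p * s) (by omega) (by rw [hs]; ring)
      hφ (hψ.contr Z) hf ha
    have i3 := ih hr hs hφ hψ (hf.contr Z) (ha.contr Z)
    have hr' : (-1 : ℝ) ^ r = -((-1) ^ p * (-1) ^ q) := by rw [hr]; ring
    simp only [Pi.sub_apply, Pi.smul_apply] at i1 i2 i3
    simp only [Pi.sub_apply, Pi.smul_apply, listInsert_cons, contr_listInsert,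
      listInsert_sub_left _ _ _ hf, listInsert_smul_left _ _ _ hf, listInsert_sub_right,
      listInsert_smul_right, hr']
    -- Once both signs are numbers, the expanded goal is a signed sum of the three contracted
    -- identities.
    rcases neg_one_pow_eq_or ℝ p with hp | hp <;> rcases neg_one_pow_eq_or ℝ q with hq | hq <;>
      simp only [hp, hq] at i1 i2 i3 ⊢
    · linear_combination (norm := module) i1 - i2 + i3
    · linear_combination (norm := module) i1 - i2 - i3
    · linear_combination (norm := module) i1 + i2 - i3
    · linear_combination (norm := module) i1 + i2 + i3

/-! ### The operators `∇_φ` on functions on lists -/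

variable (cA : L →ₗ[ℝ] L →ₗ[ℝ] L) (cE : L →ₗ[ℝ] N →ₗ[ℝ] N)

/-- `l ↦ ∇_{φ(l)} Z`. -/
def covAlong (φ : List L → L) (Z : L) : List L → L := fun l => cA (φ l) Z

theorem covAlong_apply (φ : List L → L) (Z : L) (l : List L) :
    covAlong cA φ Z l = cA (φ l) Z := rfl

@[simp]
theorem contr_covAlong (φ : List L → L) (Y Z : L) :
    contr Y (covAlong cA φ Z) = covAlong cA (contr Y φ) Z := rfl

theorem covAlong_add (φ χ : List L → L) (Z : L) :
    covAlong cA (φ + χ) Z = covAlong cA φ Z + covAlong cA χ Z := by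
  funext l; simp [covAlong]

theorem covAlong_smul (c : ℝ) (φ : List L → L) (Z : L) :
    covAlong cA (c • φ) Z = c • covAlong cA φ Z := by
  funext l; simp [covAlong]

theorem covAlong_sub (φ χ : List L → L) (Z : L) :
    covAlong cA (φ - χ) Z = covAlong cA φ Z - covAlong cA χ Z := by
  funext l; simp [covAlong]

theorem HasParity.covAlong {p : ℕ} {φ : List L → L} (h : HasParity p φ) (Z : L) :
    HasParity p (covAlong cA φ Z) := by
  intro l hl
  rw [covAlong_apply, h l hl, map_zero, LinearMap.zero_apply]

theorem covAlong_listInsert (p : ℕ) (φ ψ : List L → L) (Z : L) :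
    covAlong cA (listInsert p φ ψ) Z = listInsert p φ (covAlong cA ψ Z) :=
  (listInsert_comp p φ (cA.flip Z) ψ).symm

/-- The operator `∇_φ` for functions on lists, where `φ` has the parity of `p`. -/
def listNabla : ℕ → (List L → L) → (List L → N) → List L → N
  | _, φ, f, [] => cE (φ []) (f [])
  | p, φ, f, Z :: l =>
    listNabla (p + 1) (contr Z φ) f l + (-1 : ℝ) ^ p • listNabla p φ (contr Z f) l
      - (-1 : ℝ) ^ p • listInsert p (covAlong cA φ Z) f l

theorem listNabla_nil (p : ℕ) (φ : List L → L) (f : List L → N) :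
    listNabla cA cE p φ f [] = cE (φ []) (f []) := rfl

theorem contr_listNabla (p : ℕ) (φ : List L → L) (f : List L → N) (Z : L) :
    contr Z (listNabla cA cE p φ f) = listNabla cA cE (p + 1) (contr Z φ) f
      + (-1 : ℝ) ^ p • listNabla cA cE p φ (contr Z f)
      - (-1 : ℝ) ^ p • listInsert p (covAlong cA φ Z) f := rfl

theorem listNabla_cons (p : ℕ) (φ : List L → L) (f : List L → N) (Z : L) (l : List L) :
    listNabla cA cE p φ f (Z :: l) = listNabla cA cE (p + 1) (contr Z φ) f l
      + (-1 : ℝ) ^ p • listNabla cA cE p φ (contr Z f) l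
      - (-1 : ℝ) ^ p • listInsert p (covAlong cA φ Z) f l := rfl

theorem listNabla_add_right (p : ℕ) (φ : List L → L) (f g : List L → N) :
    listNabla cA cE p φ (f + g) = listNabla cA cE p φ f + listNabla cA cE p φ g := by
  funext l
  induction l generalizing p φ f g with
  | nil => simp [listNabla_nil]
  | cons Z l ih =>
    simp only [listNabla_cons, contr_add, ih, Pi.add_apply, listInsert_add_right]; module

theorem listNabla_smul_right (p : ℕ) (φ : List L → L) (c : ℝ) (f : List L → N) :
    listNabla cA cE p φ (c • f) = c • listNabla cA cE p φ f := by
  funext l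
  induction l generalizing p φ f with
  | nil => simp [listNabla_nil]
  | cons Z l ih =>
    simp only [listNabla_cons, contr_smul, ih, Pi.smul_apply, listInsert_smul_right]; module

theorem listNabla_sub_right (p : ℕ) (φ : List L → L) (f g : List L → N) :
    listNabla cA cE p φ (f - g) = listNabla cA cE p φ f - listNabla cA cE p φ g := by
  have h : f - g = f + (-1 : ℝ) • g := by module
  rw [h, listNabla_add_right, listNabla_smul_right]; module

theorem listNabla_add_left (p : ℕ) (φ χ : List L → L) {f : List L → N} (hf : LastLinear f) :
    listNabla cA cE p (φ + χ) f = listNabla cA cE p φ f + listNabla cA cE p χ f := by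
  funext l
  induction l generalizing p φ χ f with
  | nil => simp [listNabla_nil]
  | cons Z l ih =>
    simp only [listNabla_cons, contr_add, ih _ _ _ hf, ih _ _ _ (hf.contr Z), Pi.add_apply,
      covAlong_add, listInsert_add_left _ _ _ hf]
    module

theorem listNabla_smul_left (p : ℕ) (c : ℝ) (φ : List L → L) {f : List L → N}
    (hf : LastLinear f) : listNabla cA cE p (c • φ) f = c • listNabla cA cE p φ f := by
  funext l
  induction l generalizing p φ f with
  | nil => simp [listNabla_nil]
  | cons Z l ih =>
    simp only [listNabla_cons, contr_smul, ih _ _ hf, ih _ _ (hf.contr Z), Pi.smul_apply,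
      covAlong_smul, listInsert_smul_left _ _ _ hf]
    module

theorem listNabla_sub_left (p : ℕ) (φ χ : List L → L) {f : List L → N} (hf : LastLinear f) :
    listNabla cA cE p (φ - χ) f = listNabla cA cE p φ f - listNabla cA cE p χ f := by
  have h : φ - χ = φ + (-1 : ℝ) • χ := by module
  rw [h, listNabla_add_left _ _ _ _ _ hf, listNabla_smul_left _ _ _ _ _ hf]; module

/-- The commutator of `∇_φ` with an insertion. -/
theorem listNabla_listInsert {p q r : ℕ} (hr : r = p + q + 1) {s : ℝ}
    (hs : s = (-1) ^ (p * (q + 1))) {φ ψ : List L → L} (hφ : HasParity p φ)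
    (hψ : HasParity q ψ) {f : List L → N} (hf : LastLinear f) (ha : LastAlt f) :
    listNabla cA cE p φ (listInsert q ψ f) - s • listInsert q ψ (listNabla cA cE p φ f)
      = listInsert (p + q) (listNabla cA cA p φ ψ) f
        - s • listNabla cA cE r (listInsert q ψ φ) f := by
  funext l
  induction l generalizing p q r s φ ψ f with
  | nil =>
    simp only [Pi.sub_apply, Pi.smul_apply, listInsert_nil, listNabla_nil,
      listNabla_cons, contr_apply, covAlong_apply]
    -- For even `p` the sign is `s = 1` and the two derivatives of `f [ψ []]` along `φ []` cancel;
    -- for odd `p` the value `φ []` is zero.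
    rcases Nat.even_or_odd p with hp | hp
    · have : s = 1 := by
        rw [hs]; exact (hp.mul_right _).neg_one_pow
      rw [this, hp.neg_one_pow]
      module
    · simp only [hφ.nil_eq_zero hp, map_zero, LinearMap.zero_apply, hf.single_zero]
      module
  | cons Z l ih =>
    have i1 := ih (r := r + 1) (s := -(-1) ^ q * s) (by omega) (by rw [hs]; ring)
      (hφ.contr Z) hψ hf ha
    have i2 := ih (r := r + 1) (s := (-1) ^ p * s) (by omega) (by rw [hs]; ring)
      hφ (hψ.contr Z) hf ha
    have i3 := ih hr hs hφ hψ (hf.contr Z) (ha.contr Z)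
    -- The term `i_{∇_φ Z}` in the contraction of `∇_φ` meets `i_ψ`. The resulting commutator of
    -- insertions has sign `(-1) ^ ((p + 1) * (q + 1)) = -(-1) ^ q * s`.
    have i4 := congrFun (listInsert_listInsert (r := r) (s := -(-1) ^ q * s) hr
      (by rw [hs]; ring) (hφ.covAlong cA Z) hψ hf ha) l
    have e1 : p + 1 + q = p + q + 1 := by omega
    have e2 : p + (q + 1) = p + q + 1 := by omega
    rw [listInsert_congr_parity (p := r) (q := p + q + 1) (by grind),
      listInsert_congr_parity (p := r) (q := r) (by grind)] at i4
    have hr' : (-1 : ℝ) ^ r = -((-1) ^ p * (-1) ^ q) := by rw [hr]; ring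
    simp only [Pi.sub_apply, Pi.smul_apply, e1, e2] at i1 i2 i3 i4
    simp only [Pi.sub_apply, Pi.smul_apply, Pi.add_apply, listInsert_cons, contr_listInsert,
      contr_listNabla, listNabla_cons, covAlong_listInsert,
      listInsert_add_right, listNabla_sub_right, listNabla_smul_right,
      listInsert_sub_left _ _ _ hf, listInsert_add_left _ _ _ hf,
      listNabla_sub_left _ _ _ _ _ hf, listNabla_smul_left _ _ _ _ _ hf,
      listInsert_smul_left _ _ _ hf, listInsert_sub_right,
      listInsert_smul_right, hr', pow_add (-1 : ℝ) p q]
    rcases neg_one_pow_eq_or ℝ p with hp | hp <;> rcases neg_one_pow_eq_or ℝ q with hq | hq <;>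
      simp only [hp, hq] at i1 i2 i3 i4 ⊢
    · linear_combination (norm := module) i1 + i2 - i3 - i4
    · linear_combination (norm := module) i1 + i2 + i3 - i4
    · linear_combination (norm := module) i1 - i2 + i3 + i4
    · linear_combination (norm := module) i1 - i2 - i3 + i4

end ListForms


/-! ### Curvature forms and the commutator of `∇_φ` and `∇_ψ` on lists -/

section ListForms

variable {L N : Type*} [AddCommGroup L] [Module ℝ L] [AddCommGroup N] [Module ℝ N]

/-- The form `φ ∧ ψ ∧ R(·,·)Z` for functions on lists, where `φ` has the parity of `p`. -/
def listCurvAt (R : L → L → L → L) (Z : L) : ℕ → (List L → L) → (List L → L) → List L → L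
  | _, φ, ψ, [] => R (φ []) (ψ []) Z
  | p, φ, ψ, Y :: l => listCurvAt R Z (p + 1) (contr Y φ) ψ l
      + (-1 : ℝ) ^ p • listCurvAt R Z p φ (contr Y ψ) l

/-- The form `R(φ,ψ)` for functions on lists, where `φ`, `ψ` have the parity of `p`, `q`. -/
def listCurv (R : L → L → L → L) : ℕ → ℕ → (List L → L) → (List L → L) → List L → L
  | _, _, _, _, [] => 0
  | p, q, φ, ψ, Z :: l => listCurv R (p + 1) q (contr Z φ) ψ l
      + (-1 : ℝ) ^ p • listCurv R p (q + 1) φ (contr Z ψ) l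
      + (-1 : ℝ) ^ (p + q) • listCurvAt R Z p φ ψ l

theorem contr_listCurv (R : L → L → L → L) (p q : ℕ) (φ ψ : List L → L) (Z : L) :
    contr Z (listCurv R p q φ ψ) = listCurv R (p + 1) q (contr Z φ) ψ
      + (-1 : ℝ) ^ p • listCurv R p (q + 1) φ (contr Z ψ)
      + (-1 : ℝ) ^ (p + q) • listCurvAt R Z p φ ψ := rfl

theorem listCurv_cons (R : L → L → L → L) (p q : ℕ) (φ ψ : List L → L) (Z : L) (l : List L) :
    listCurv R p q φ ψ (Z :: l) = listCurv R (p + 1) q (contr Z φ) ψ l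
      + (-1 : ℝ) ^ p • listCurv R p (q + 1) φ (contr Z ψ) l
      + (-1 : ℝ) ^ (p + q) • listCurvAt R Z p φ ψ l := rfl

theorem listCurvAt_cons (R : L → L → L → L) (Z : L) (p : ℕ) (φ ψ : List L → L) (Y : L)
    (l : List L) : listCurvAt R Z p φ ψ (Y :: l) = listCurvAt R Z (p + 1) (contr Y φ) ψ l
      + (-1 : ℝ) ^ p • listCurvAt R Z p φ (contr Y ψ) l := rfl

variable (cA : L →ₗ[ℝ] L →ₗ[ℝ] L) (cE : L →ₗ[ℝ] N →ₗ[ℝ] N)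

/-- The curvature of a torsion-free connection, whose bracket is `∇_x y - ∇_y x`. -/
def torsionFreeCurv (x y z : L) : L :=
  cA x (cA y z) - cA y (cA x z) - cA (cA x y - cA y x) z

theorem covAlong_cons (φ : List L → L) (Y Z : L) (l : List L) :
    covAlong cA φ Z (Y :: l) = covAlong cA (contr Y φ) Z l := rfl

/-- This is the Ricci identity for the fixed field `Z` with form-valued directions. On the empty
list it is the definition of the curvature. Under contraction the two insertion terms of each
covariant second derivative cancel by `covAlong_listInsert`, so the identity reduces to its
instances for the contracted `φ` and `ψ`. -/
theorem listNabla_covAlong {p q : ℕ} {s : ℝ} (hs : s = (-1) ^ (p * q)) {φ ψ : List L → L}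
    (hφ : HasParity p φ) (hψ : HasParity q ψ) (Z : L) :
    listNabla cA cA p φ (covAlong cA ψ Z) - covAlong cA (listNabla cA cA p φ ψ) Z
        - s • (listNabla cA cA q ψ (covAlong cA φ Z) - covAlong cA (listNabla cA cA q ψ φ) Z)
      = listCurvAt (torsionFreeCurv cA) Z p φ ψ := by
  funext l
  induction l generalizing p q s φ ψ with
  | nil =>
    simp only [Pi.sub_apply, Pi.smul_apply, listNabla_nil, covAlong_apply, listCurvAt,
      torsionFreeCurv]
    rcases Nat.even_or_odd p with hp | hp
    · have : s = 1 := by rw [hs]; exact (hp.mul_right _).neg_one_pow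
      simp only [this, map_sub, LinearMap.sub_apply]
      module
    · simp [hφ.nil_eq_zero hp]
  | cons Y l ih =>
    have i1 := ih (s := (-1) ^ q * s) (by rw [hs]; ring) (hφ.contr Y) hψ
    have i2 := ih (s := (-1) ^ p * s) (by rw [hs]; ring) hφ (hψ.contr Y)
    simp only [Pi.sub_apply, Pi.smul_apply, smul_sub] at i1 i2
    simp only [Pi.sub_apply, Pi.smul_apply, Pi.add_apply, listCurvAt_cons, listNabla_cons,
      covAlong_cons, contr_listNabla, contr_covAlong, smul_sub, covAlong_add, covAlong_sub,
      covAlong_smul, covAlong_listInsert]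
    rcases neg_one_pow_eq_or ℝ p with hp | hp <;> rcases neg_one_pow_eq_or ℝ q with hq | hq <;>
      simp only [hp, hq] at i1 i2 ⊢
    · linear_combination (norm := module) i1 + i2
    · linear_combination (norm := module) i1 + i2
    · linear_combination (norm := module) i1 - i2
    · linear_combination (norm := module) i1 - i2

/-- The commutator of the operators `∇_φ` and `∇_ψ` on functions on lists. -/
theorem listNabla_listNabla
    (hflat : ∀ x y n, cE x (cE y n) - cE y (cE x n) - cE (cA x y - cA y x) n = 0)
    {p q : ℕ} {s : ℝ} (hs : s = (-1) ^ (p * q)) {φ ψ : List L → L}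
    (hφ : HasParity p φ) (hψ : HasParity q ψ) {f : List L → N} (hf : LastLinear f)
    (ha : LastAlt f) :
    listNabla cA cE p φ (listNabla cA cE q ψ f) - s • listNabla cA cE q ψ (listNabla cA cE p φ f)
      = listNabla cA cE (p + q) (listNabla cA cA p φ ψ) f
        - s • listNabla cA cE (p + q) (listNabla cA cA q ψ φ) f
        - listInsert (p + q + 1) (listCurv (torsionFreeCurv cA) p q φ ψ) f := by
  funext l
  induction l generalizing p q s φ ψ f with
  | nil =>
    simp only [Pi.sub_apply, Pi.smul_apply, listInsert_nil, listNabla_nil, listCurv,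
      hf.single_zero]
    -- On the empty list the curvature form of `A` vanishes, and for even `p` the claim is flatness
    -- in the directions `φ []`, `ψ []`. For odd `p` the value `φ []` is zero.
    rcases Nat.even_or_odd p with hp | hp
    · have : s = 1 := by rw [hs]; exact (hp.mul_right _).neg_one_pow
      have h := hflat (φ []) (ψ []) (f [])
      simp only [map_sub, LinearMap.sub_apply] at h
      rw [this]
      linear_combination (norm := module) h
    · simp [hφ.nil_eq_zero hp]
  | cons Z l ih =>
    have e1 : p + 1 + q = p + q + 1 := by omega
    have e2 : p + (q + 1) = p + q + 1 := by omega
    have e3 : q + p = p + q := by omega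
    have i1 := ih (s := (-1) ^ q * s) (by rw [hs]; ring) (hφ.contr Z) hψ hf ha
    have i2 := ih (s := (-1) ^ p * s) (by rw [hs]; ring) hφ (hψ.contr Z) hf ha
    have i3 := ih hs hφ hψ (hf.contr Z) (ha.contr Z)
    -- The cross terms pair `∇_φ` with `i_{∇_ψ Z}` and `∇_ψ` with `i_{∇_φ Z}`. Their signs are `(-1)
    -- ^ (p * (q + 1))` and `(-1) ^ (q * (p + 1))`.
    have i4 := congrFun (listNabla_listInsert cA cE (r := p + q + 1) (s := (-1) ^ p * s) rfl
      (by rw [hs]; ring) hφ (hψ.covAlong cA Z) hf ha) l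
    have i5 := congrFun (listNabla_listInsert cA cE (r := p + q + 1) (s := (-1) ^ q * s)
      (by omega) (by rw [hs]; ring) hψ (hφ.covAlong cA Z) hf ha) l
    -- The second derivatives of `Z` left by the cross terms combine to the part of `R(φ,ψ)` in
    -- which `Z` is the third argument of the curvature.
    have i6 := congrFun (congrArg (fun g => listInsert (p + q) g f)
      (listNabla_covAlong cA hs hφ hψ Z)) l
    simp only [Pi.sub_apply, Pi.smul_apply, e1, e2, e3, listInsert_sub_left _ _ _ hf,
      listInsert_smul_left _ _ _ hf] at i1 i2 i3 i4 i5 i6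
    rw [listInsert_congr_parity (p := p + q + 1 + 1) (q := p + q) (by grind)] at i1 i2
    simp only [Pi.sub_apply, Pi.smul_apply, Pi.add_apply, listInsert_cons, 
      contr_listNabla, listNabla_cons, contr_listCurv, listNabla_sub_right, listNabla_add_right, listNabla_smul_right,
      listInsert_add_left _ _ _ hf,
      listNabla_sub_left _ _ _ _ _ hf, listNabla_smul_left _ _ _ _ _ hf,
      listNabla_add_left _ _ _ _ _ hf,
      listInsert_smul_left _ _ _ hf, pow_succ, pow_add (-1 : ℝ) p q]
    rw [listInsert_congr_parity (p := p + q + 1 + 1) (q := p + q) (by grind),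
      listInsert_congr_parity (p := p + q + 1 + 1) (q := p + q) (by grind),
      listInsert_congr_parity (p := p + q + 1 + 1) (q := p + q) (by grind)]
    -- The identity `i5` comes from the product already multiplied by `s`, so it enters with a
    -- coefficient containing `s`, and `s * s = 1` is needed.
    have hs1 : s = 1 ∨ s = -1 := by rw [hs]; exact neg_one_pow_eq_or ℝ _
    rcases neg_one_pow_eq_or ℝ p with hp | hp <;> rcases neg_one_pow_eq_or ℝ q with hq | hq <;>
      simp only [hp, hq] at i1 i2 i3 i4 i5 i6 ⊢
    · rcases hs1 with hs1 | hs1 <;> simp only [hs1] at i1 i2 i3 i4 i5 i6 ⊢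
      · linear_combination (norm := module) i1 + i2 + i3 - i4 + i5 - i6
      · linear_combination (norm := module) i1 + i2 + i3 - i4 - i5 - i6
    · rcases hs1 with hs1 | hs1 <;> simp only [hs1] at i1 i2 i3 i4 i5 i6 ⊢
      · linear_combination (norm := module) i1 + i2 - i3 + i4 - i5 + i6
      · linear_combination (norm := module) i1 + i2 - i3 + i4 + i5 + i6
    · rcases hs1 with hs1 | hs1 <;> simp only [hs1] at i1 i2 i3 i4 i5 i6 ⊢
      · linear_combination (norm := module) i1 - i2 - i3 + i4 - i5 + i6
      · linear_combination (norm := module) i1 - i2 - i3 + i4 + i5 + i6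
    · rcases hs1 with hs1 | hs1 <;> simp only [hs1] at i1 i2 i3 i4 i5 i6 ⊢
      · linear_combination (norm := module) i1 - i2 + i3 - i4 + i5 - i6
      · linear_combination (norm := module) i1 - i2 + i3 - i4 - i5 - i6

/-! ### Lie and exterior derivatives on functions on lists -/

/-- The Lie derivative along `Z` for functions on lists, with the bracket `br`. -/
def listLie (br : L → L → L) (Z : L) : (List L → N) → List L → N
  | f, [] => cE Z (f [])
  | f, Y :: l => listLie br Z (contr Y f) l - f (br Z Y :: l)

/-- The exterior derivative for functions on lists. -/
def listDeriv (br : L → L → L) : (List L → N) → List L → N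
  | _, [] => 0
  | f, Z :: l => listLie cE br Z f l - listDeriv br (contr Z f) l

theorem listLie_nil (br : L → L → L) (Z : L) (f : List L → N) :
    listLie cE br Z f [] = cE Z (f []) := rfl

theorem listLie_cons (br : L → L → L) (Z : L) (f : List L → N) (Y : L) (l : List L) :
    listLie cE br Z f (Y :: l) = listLie cE br Z (contr Y f) l - f (br Z Y :: l) := rfl

theorem contr_listLie (br : L → L → L) (Z : L) (f : List L → N) (Y : L) :
    contr Y (listLie cE br Z f) = listLie cE br Z (contr Y f) - contr (br Z Y) f := rfl

theorem listLie_add (br : L → L → L) (Z : L) (f g : List L → N) :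
    listLie cE br Z (f + g) = listLie cE br Z f + listLie cE br Z g := by
  funext l
  induction l generalizing f g with
  | nil => simp [listLie_nil]
  | cons Y l ih => simp only [listLie_cons, contr_add, ih, Pi.add_apply]; module

theorem listLie_smul (br : L → L → L) (Z : L) (c : ℝ) (f : List L → N) :
    listLie cE br Z (c • f) = c • listLie cE br Z f := by
  funext l
  induction l generalizing f with
  | nil => simp [listLie_nil]
  | cons Y l ih => simp only [listLie_cons, contr_smul, ih, Pi.smul_apply]; module

theorem listLie_sub (br : L → L → L) (Z : L) (f g : List L → N) :
    listLie cE br Z (f - g) = listLie cE br Z f - listLie cE br Z g := by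
  have h : f - g = f + (-1 : ℝ) • g := by module
  rw [h, listLie_add, listLie_smul]; module

theorem listDeriv_nil (br : L → L → L) (f : List L → N) : listDeriv cE br f [] = 0 := rfl

theorem listDeriv_cons (br : L → L → L) (f : List L → N) (Z : L) (l : List L) :
    listDeriv cE br f (Z :: l) = listLie cE br Z f l - listDeriv cE br (contr Z f) l := rfl

theorem contr_listDeriv (br : L → L → L) (f : List L → N) (Z : L) :
    contr Z (listDeriv cE br f) = listLie cE br Z f - listDeriv cE br (contr Z f) := rfl

theorem listDeriv_add (br : L → L → L) (f g : List L → N) :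
    listDeriv cE br (f + g) = listDeriv cE br f + listDeriv cE br g := by
  funext l
  induction l generalizing f g with
  | nil => simp [listDeriv_nil]
  | cons Y l ih => simp only [listDeriv_cons, contr_add, ih, Pi.add_apply, listLie_add]; module

theorem listDeriv_smul (br : L → L → L) (c : ℝ) (f : List L → N) :
    listDeriv cE br (c • f) = c • listDeriv cE br f := by
  funext l
  induction l generalizing f with
  | nil => simp [listDeriv_nil]
  | cons Y l ih => simp only [listDeriv_cons, contr_smul, ih, Pi.smul_apply, listLie_smul]; module

theorem listDeriv_sub (br : L → L → L) (f g : List L → N) :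
    listDeriv cE br (f - g) = listDeriv cE br f - listDeriv cE br g := by
  have h : f - g = f + (-1 : ℝ) • g := by module
  rw [h, listDeriv_add, listDeriv_smul]; module

/-- The Lie derivative moves the inserted entry by `[Z, φ] = ∇_Z φ - ∇_φ Z`. Differentiating the
values of `φ` by `∇_Z` accounts for the first part only, and `∇_φ Z` is the correction. -/
theorem listLie_listInsert {br : L → L → L} (hbr : ∀ x y, br x y = cA x y - cA y x)
    (Z : L) (p : ℕ) (φ : List L → L) {f : List L → N} (hf : LastLinear f) :
    listLie cE br Z (listInsert p φ f) - listInsert p φ (listLie cE br Z f)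
      = listInsert p (listLie cA br Z φ) f - listInsert p (covAlong cA φ Z) f := by
  funext l
  induction l generalizing p φ f with
  | nil =>
    simp only [Pi.sub_apply, listLie_nil, listInsert_nil, listLie_cons, contr_apply,
      covAlong_apply, hbr, hf.single_sub]
    module
  | cons Y l ih =>
    have i1 := ih (p + 1) (contr Y φ) hf
    have i2 := ih p φ (hf.contr Y)
    simp only [Pi.sub_apply] at i1 i2
    simp only [Pi.sub_apply, listLie_cons, listInsert_cons, contr_listInsert, contr_listLie,
      listLie_sub, listLie_smul, Pi.smul_apply, listInsert_sub_left _ _ _ hf,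
      listInsert_sub_right, contr_covAlong]
    linear_combination (norm := module) i1 - (-1 : ℝ) ^ p • i2

/-- `∇_φ = i_φ d + (-1)^p d i_φ - (-1)^p i_{dφ}` for functions on lists. -/
theorem listNabla_eq {br : L → L → L} (hbr : ∀ x y, br x y = cA x y - cA y x)
    (p : ℕ) (φ : List L → L) {f : List L → N} (hf : LastLinear f) :
    listNabla cA cE p φ f = listInsert p φ (listDeriv cE br f)
        + (-1 : ℝ) ^ p • listDeriv cE br (listInsert p φ f)
        - (-1 : ℝ) ^ p • listInsert (p + 1) (listDeriv cA br φ) f := by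
  funext l
  induction l generalizing p φ f with
  | nil =>
    simp only [Pi.sub_apply, Pi.add_apply, Pi.smul_apply, listNabla_nil, listInsert_nil,
      listDeriv_cons, listDeriv_nil, listLie_nil, hf.single_zero]
    module
  | cons Z l ih =>
    have i1 := ih (p + 1) (contr Z φ) hf
    have i2 := ih p φ (hf.contr Z)
    -- Since `ι_Z d = L_Z - d ι_Z`, contraction leaves a commutator of `L_Z` with `i_φ`. It supplies
    -- the term `i_{∇_φ Z}` in the recursion for `∇_φ`.
    have i3 := congrFun (listLie_listInsert cA cE hbr Z p φ hf) l
    have hsq : (-1 : ℝ) ^ p = 1 ∨ (-1 : ℝ) ^ p = -1 := neg_one_pow_eq_or ℝ p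
    rw [← listInsert_congr_parity (p := p + 1 + 1) (q := p) (by grind) (listLie cA br Z φ)]
      at i3
    simp only [Pi.sub_apply, Pi.add_apply, Pi.smul_apply] at i1 i2 i3
    simp only [Pi.sub_apply, Pi.add_apply, Pi.smul_apply, listNabla_cons, listInsert_cons,
      listDeriv_cons, contr_listInsert, contr_listDeriv, listDeriv_sub, listDeriv_smul,
      listInsert_sub_left _ _ _ hf, listInsert_sub_right, pow_succ] at i1 ⊢
    rcases hsq with hp | hp <;> simp only [hp] at i1 i2 ⊢
    · linear_combination (norm := module) i1 + i2 - i3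
    · linear_combination (norm := module) i1 - i2 + i3

/-! ### Degrees of functions on lists -/

/-- The vanishing of `f` on lists of length other than `n`. -/
def HasDegree (n : ℤ) (f : List L → N) : Prop := ∀ l, (l.length : ℤ) ≠ n → f l = 0

/-- Degrees are integers so that contracting degree `0` gives degree `-1`, which forces the function
to be zero. -/
theorem HasDegree.contr {n : ℤ} {f : List L → N} (h : HasDegree n f) (Z : L) :
    HasDegree (n - 1) (contr Z f) := by
  intro l hl
  refine h (Z :: l) ?_
  rw [List.length_cons]; push_cast; omega

theorem HasDegree.hasParity {n : ℕ} {f : List L → N} (h : HasDegree n f) : HasParity n f := by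
  intro l hl
  refine h l fun h' => hl ?_
  have : l.length = n := by omega
  rw [this]; exact ⟨n, rfl⟩

theorem HasDegree.listInsert {k m : ℤ} {φ : List L → L} {f : List L → N} (p : ℕ)
    (hφ : HasDegree k φ) (h : HasDegree m f) (hf : LastLinear f) :
    HasDegree (k + m - 1) (listInsert p φ f) := by
  intro l hl
  induction l generalizing p φ f k m with
  | nil =>
    rw [listInsert_nil]
    -- Either `φ []` vanishes, or `k = 0` and then `m ≠ 1`, so that `f` vanishes on one-entry lists.
    by_cases hk : (0 : ℤ) = k
    · refine h _ ?_
      simp only [List.length_nil, List.length_cons] at hl ⊢; push_cast at hl ⊢; omega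
    · rw [hφ [] (by simpa using hk), hf.single_zero]
  | cons Z l ih =>
    rw [List.length_cons] at hl
    push_cast at hl
    rw [listInsert_cons, ih _ (hφ.contr Z) h hf (by omega),
      ih _ hφ (h.contr Z) (hf.contr Z) (by omega), smul_zero, sub_zero]

theorem HasDegree.covAlong {k : ℤ} {φ : List L → L} (hφ : HasDegree k φ) (Z : L) :
    HasDegree k (covAlong cA φ Z) := by
  intro l hl
  rw [covAlong_apply, hφ l hl, map_zero, LinearMap.zero_apply]

theorem HasDegree.listNabla {k m : ℤ} {φ : List L → L} {f : List L → N} (p : ℕ)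
    (hφ : HasDegree k φ) (h : HasDegree m f) (hf : LastLinear f) :
    HasDegree (k + m) (listNabla cA cE p φ f) := by
  intro l hl
  induction l generalizing p φ f k m with
  | nil =>
    rw [listNabla_nil]
    by_cases hk : (0 : ℤ) = k
    · rw [h [] (by simp only [List.length_nil] at hl ⊢; push_cast at hl ⊢; omega), map_zero]
    · rw [hφ [] (by simpa using hk), map_zero, LinearMap.zero_apply]
  | cons Z l ih =>
    rw [List.length_cons] at hl
    push_cast at hl
    rw [listNabla_cons, ih _ (hφ.contr Z) h hf (by omega),
      ih _ hφ (h.contr Z) (hf.contr Z) (by omega),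
      (hφ.covAlong cA Z).listInsert p h hf l (by omega), smul_zero, add_zero,
      sub_zero]

end ListForms


/-! ### Recursion for sums over shuffles -/

section ShuffleRecursion

/-- The permutation of `Fin (n + 1)` which sends `p` to `0` and is `τ` on the other entries. -/
def consPerm {n : ℕ} (p : Fin (n + 1)) (τ : Equiv.Perm (Fin n)) : Equiv.Perm (Fin (n + 1)) :=
  Equiv.Perm.decomposeFin.symm (0, τ) * p.cycleRange

theorem consPerm_self {n : ℕ} (p : Fin (n + 1)) (τ : Equiv.Perm (Fin n)) :
    consPerm p τ p = 0 := by
  rw [consPerm, Equiv.Perm.mul_apply, Fin.cycleRange_self,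
    Equiv.Perm.decomposeFin_symm_apply_zero]

theorem consPerm_succAbove {n : ℕ} (p : Fin (n + 1)) (τ : Equiv.Perm (Fin n)) (j : Fin n) :
    consPerm p τ (p.succAbove j) = (τ j).succ := by
  rw [consPerm, Equiv.Perm.mul_apply, Fin.cycleRange_succAbove,
    Equiv.Perm.decomposeFin_symm_apply_succ, Equiv.swap_self, Equiv.refl_apply]

/-- The factor `(-1) ^ p` is the sign of the cycle of length `p + 1` that carries position `p` to
the front. -/
theorem sign_consPerm {n : ℕ} (p : Fin (n + 1)) (τ : Equiv.Perm (Fin n)) :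
    Equiv.Perm.sign (consPerm p τ) = (-1) ^ (p : ℕ) * Equiv.Perm.sign τ := by
  rw [consPerm, Equiv.Perm.sign_mul, Equiv.Perm.decomposeFin.symm_sign, Fin.sign_cycleRange,
    if_pos rfl, one_mul, mul_comm]

/-- The position of the value `0` and the induced permutation of the other entries determine a
permutation. Injectivity is enough, because `(n + 1) * n! = (n + 1)!`. -/
theorem consPerm_bijective (n : ℕ) :
    Function.Bijective fun x : Fin (n + 1) × Equiv.Perm (Fin n) => consPerm x.1 x.2 := by
  rw [Fintype.bijective_iff_injective_and_card]
  constructor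
  · rintro ⟨p, τ⟩ ⟨p', τ'⟩ h
    dsimp only at h
    have hp : p = p' := by
      have h1 := consPerm_self p τ
      rw [h, ← consPerm_self p' τ'] at h1
      exact (consPerm p' τ').injective h1
    subst hp
    congr 1
    ext1 j
    have h1 := consPerm_succAbove p τ j
    rw [h, consPerm_succAbove] at h1
    exact (Fin.succ_injective _ h1).symm
  · rw [Fintype.card_prod, Fintype.card_perm, Fintype.card_perm, Fintype.card_fin,
      Fintype.card_fin, Nat.factorial_succ]

theorem sum_perm_succ {N : Type*} [AddCommMonoid N] {n : ℕ}
    (f : Equiv.Perm (Fin (n + 1)) → N) :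
    ∑ σ, f σ = ∑ p, ∑ τ, f (consPerm p τ) := by
  rw [← Fintype.sum_prod_type', ← (consPerm_bijective n).sum_comp]

/-- The least value sits at `p`, so an order condition involving `p` can fail only against an
earlier position of the same block. -/
theorem consPerm_mem_iff {n : ℕ} (same : Fin (n + 1) → Fin (n + 1) → Prop) (p : Fin (n + 1))
    (τ : Equiv.Perm (Fin n)) :
    (∀ i j, i < j → same i j → consPerm p τ i < consPerm p τ j) ↔
      (∀ i, i < p → ¬ same i p) ∧
        ∀ i j, i < j → same (p.succAbove i) (p.succAbove j) → τ i < τ j := by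
  constructor
  · intro h
    refine ⟨fun i hi hs => ?_, fun i j hij hs => ?_⟩
    · have := h i p hi hs
      rw [consPerm_self] at this
      exact absurd this (by simp)
    · have := h _ _ (Fin.succAbove_lt_succAbove_iff.mpr hij) hs
      rwa [consPerm_succAbove, consPerm_succAbove, Fin.succ_lt_succ_iff] at this
  · rintro ⟨h1, h2⟩ i j hij hs
    rcases Fin.eq_self_or_eq_succAbove p j with rfl | ⟨j, rfl⟩
    · exact absurd hs (h1 i hij)
    · rcases Fin.eq_self_or_eq_succAbove p i with rfl | ⟨i, rfl⟩
      · rw [consPerm_self, consPerm_succAbove]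
        exact Fin.succ_pos _
      · rw [consPerm_succAbove, consPerm_succAbove, Fin.succ_lt_succ_iff]
        exact h2 i j (Fin.succAbove_lt_succAbove_iff.mp hij) hs

theorem cons_consPerm {L : Type*} {n : ℕ} (Z : L) (v : Fin n → L) (p : Fin (n + 1))
    (τ : Equiv.Perm (Fin n)) :
    (fun i => (Fin.cons Z v : Fin (n + 1) → L) (consPerm p τ i))
      = p.insertNth (α := fun _ => L) Z fun j => v (τ j) := by
  funext i
  rcases Fin.eq_self_or_eq_succAbove p i with rfl | ⟨j, rfl⟩
  · rw [consPerm_self, Fin.insertNth_apply_same, Fin.cons_zero]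
  · rw [consPerm_succAbove, Fin.insertNth_apply_succAbove, Fin.cons_succ]

theorem ofFn_insertNth {L : Type*} {n : ℕ} (Z : L) (w : Fin n → L) (p : Fin (n + 1)) :
    List.ofFn (p.insertNth (α := fun _ => L) Z w)
      = (List.ofFn w).take p ++ Z :: (List.ofFn w).drop p := by
  have hp := p.2
  refine List.ext_getElem (by simp; omega) fun m h1 h2 => ?_
  rw [List.getElem_ofFn]
  have hm : m < n + 1 := by simpa using h1
  have hlen : ((List.ofFn w).take p).length = p := by simp; omega
  rcases Fin.eq_self_or_eq_succAbove p ⟨m, hm⟩ with h | ⟨j, h⟩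
  · rw [h, Fin.insertNth_apply_same]
    have hmp : m = p := congrArg Fin.val h
    subst hmp
    rw [List.getElem_append_right (by omega)]
    simp [hlen]
  · rw [h, Fin.insertNth_apply_succAbove]
    have hv : m = (p.succAbove j : ℕ) := congrArg Fin.val h
    by_cases hj : (j : ℕ) < p
    · rw [Fin.succAbove_of_castSucc_lt _ _ (by simpa [Fin.lt_def] using hj)] at hv
      have hmj : m = j := by simpa using hv
      subst hmj
      rw [List.getElem_append_left (by omega)]
      simp
    · rw [Fin.succAbove_of_le_castSucc _ _ (by simpa [Fin.le_def] using hj)] at hv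
      have hmj : m = j + 1 := by simpa using hv
      subst hmj
      rw [List.getElem_append_right (by omega)]
      have e : (j : ℕ) + 1 - ((List.ofFn w).take p).length = (j - p) + 1 := by omega
      simp only [e, List.getElem_cons_succ, List.getElem_drop, List.getElem_ofFn]
      congr 1
      ext
      simp only; omega

variable {L N : Type*} [AddCommGroup N] [Module ℝ N]

theorem neg_one_pow_mul_smul (c : ℕ) (u : ℤˣ) (x : N) :
    ((-1 : ℤˣ) ^ c * u) • x = (-1 : ℝ) ^ c • u • x := by
  rw [mul_smul]
  rcases Nat.even_or_odd c with h | h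
  · rw [h.neg_one_pow, h.neg_one_pow, one_smul, one_smul]
  · rw [h.neg_one_pow, h.neg_one_pow, neg_smul, one_smul, Units.neg_smul, one_smul]

/-- The sum over the `(k, l, n - k - l)`-shuffles of the entries of a list of length `n`. -/
def shuffleSum (k l : ℕ) (G : List L → N) (t : List L) : N :=
  ∑ σ ∈ shuffles₃ k l t.length, Equiv.Perm.sign σ • G (List.ofFn fun i => t.get (σ i))

theorem shuffleSum_ofFn (k l : ℕ) (G : List L → N) {n : ℕ} (v : Fin n → L) :
    shuffleSum k l G (List.ofFn v)
      = ∑ σ ∈ shuffles₃ k l n, Equiv.Perm.sign σ • G (List.ofFn fun i => v (σ i)) := by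
  -- With an arbitrary list in place of `List.ofFn v`, the length equation can be substituted and no
  -- cast of permutations is needed.
  have key : ∀ (t : List L) (h : t.length = n) (w : Fin n → L),
      (∀ i, t.get (i.cast h.symm) = w i) → shuffleSum k l G t
        = ∑ σ ∈ shuffles₃ k l n, Equiv.Perm.sign σ • G (List.ofFn fun i => w (σ i)) := by
    intro t h w hw
    subst h
    obtain rfl : t.get = w := funext hw
    rfl
  exact key _ (List.length_ofFn) v (by intro i; simp)

theorem shuffleSum_congr {k l : ℕ} {G G' : List L → N} {t : List L}
    (h : ∀ w : List L, w.length = t.length → G w = G' w) :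
    shuffleSum k l G t = shuffleSum k l G' t :=
  Finset.sum_congr rfl fun σ _ => by rw [h _ List.length_ofFn]

/-- In a shuffle the value `0` stands at the start of a nonempty block, and deleting it shortens
that block by one. The third block needs no separate condition: a position `p = k + l` already shows
that it is nonempty. -/
theorem mem_shuffles₃_consPerm {k l n : ℕ} (p : Fin (n + 1)) (τ : Equiv.Perm (Fin n)) :
    consPerm p τ ∈ shuffles₃ k l (n + 1) ↔
      ((p : ℕ) = 0 ∧ 0 < k ∧ τ ∈ shuffles₃ (k - 1) l n) ∨
      ((p : ℕ) = k ∧ 0 < l ∧ τ ∈ shuffles₃ k (l - 1) n) ∨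
      ((p : ℕ) = k + l ∧ τ ∈ shuffles₃ k l n) := by
  have hp := p.2
  have hval : ∀ j : Fin n, ((j : ℕ) < p ∧ (p.succAbove j : ℕ) = j) ∨
      ((p : ℕ) ≤ j ∧ (p.succAbove j : ℕ) = j + 1) := by
    intro j
    by_cases hj : (j : ℕ) < p
    · left
      rw [Fin.succAbove_of_castSucc_lt _ _ (by simpa [Fin.lt_def] using hj)]
      exact ⟨hj, rfl⟩
    · right
      rw [Fin.succAbove_of_le_castSucc _ _ (by simpa [Fin.le_def] using hj)]
      exact ⟨not_lt.mp hj, rfl⟩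
  simp only [shuffles₃, Finset.mem_filter, Finset.mem_univ, true_and]
  rw [consPerm_mem_iff (fun i j : Fin (n + 1) => (j : ℕ) < k ∨
    (k ≤ (i : ℕ) ∧ (j : ℕ) < k + l) ∨ k + l ≤ (i : ℕ))]
  have hfirst : (∀ i : Fin (n + 1), i < p → ¬ ((p : ℕ) < k ∨
      (k ≤ (i : ℕ) ∧ (p : ℕ) < k + l) ∨ k + l ≤ (i : ℕ))) ↔
      ((p : ℕ) = 0 ∧ 0 < k) ∨ ((p : ℕ) = k ∧ 0 < l) ∨ (p : ℕ) = k + l := by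
    constructor
    · intro h
      by_cases h0 : (p : ℕ) = 0
      · omega
      -- Testing against the first position and the one just before `p` is enough to force `p` to
      -- start a block.
      · have h1 := h ⟨0, by omega⟩ (by simp only [Fin.lt_def]; omega)
        have h2 := h ⟨p - 1, by omega⟩ (by simp only [Fin.lt_def]; omega)
        simp only at h1 h2
        omega
    · intro h i hi
      simp only [Fin.lt_def] at hi
      omega
  rw [hfirst]
  constructor
  · rintro ⟨h | h | h, h2⟩
    · refine Or.inl ⟨h.1, h.2, fun i j hij hs => h2 i j hij ?_⟩
      rcases hval i with hi | hi <;> rcases hval j with hj | hj <;> omega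
    · refine Or.inr (Or.inl ⟨h.1, h.2, fun i j hij hs => h2 i j hij ?_⟩)
      rcases hval i with hi | hi <;> rcases hval j with hj | hj <;> omega
    · refine Or.inr (Or.inr ⟨h, fun i j hij hs => h2 i j hij ?_⟩)
      rcases hval i with hi | hi <;> rcases hval j with hj | hj <;> omega
  · rintro (⟨h, h', h2⟩ | ⟨h, h', h2⟩ | ⟨h, h2⟩)
    · refine ⟨Or.inl ⟨h, h'⟩, fun i j hij hs => h2 i j hij ?_⟩
      rcases hval i with hi | hi <;> rcases hval j with hj | hj <;> omega
    · refine ⟨Or.inr (Or.inl ⟨h, h'⟩), fun i j hij hs => h2 i j hij ?_⟩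
      simp only [Fin.lt_def] at hij
      rcases hval i with hi | hi <;> rcases hval j with hj | hj <;> omega
    · refine ⟨Or.inr (Or.inr h), fun i j hij hs => h2 i j hij ?_⟩
      simp only [Fin.lt_def] at hij
      rcases hval i with hi | hi <;> rcases hval j with hj | hj <;> omega

theorem sum_fin_ite_eq {n : ℕ} (c : ℕ) (hc : c ≤ n) (X : Fin (n + 1) → N) :
    (∑ p : Fin (n + 1), if (p : ℕ) = c then X p else 0) = X ⟨c, Nat.lt_succ_of_le hc⟩ := by
  rw [Finset.sum_eq_single ⟨c, Nat.lt_succ_of_le hc⟩]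
  · simp
  · intro b _ hb
    rw [if_neg fun h => hb (Fin.ext h)]
  · simp

theorem sum_fin_ite_eq_zero {n : ℕ} (c : ℕ) (hc : n < c) (X : Fin (n + 1) → N) :
    (∑ p : Fin (n + 1), if (p : ℕ) = c then X p else 0) = 0 :=
  Finset.sum_eq_zero fun p _ => if_neg (by omega)

/-- Recursion for sums over shuffles by the position of the first entry. -/
theorem shuffleSum_cons (k l : ℕ) (G : List L → N) (Z : L) (t : List L) (ht : k + l ≤ t.length + 1) :
    shuffleSum k l G (Z :: t) =
      (if 0 < k then shuffleSum (k - 1) l (fun w => G (Z :: w)) t else 0)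
      + (if 0 < l then
          (-1 : ℝ) ^ k • shuffleSum k (l - 1) (fun w => G (w.take k ++ Z :: w.drop k)) t else 0)
      + (if k + l ≤ t.length then (-1 : ℝ) ^ (k + l) •
          shuffleSum k l (fun w => G (w.take (k + l) ++ Z :: w.drop (k + l))) t else 0) := by
  have hG : ∀ (p : Fin (t.length + 1)) (τ : Equiv.Perm (Fin t.length)),
      Equiv.Perm.sign (consPerm p τ) • G (List.ofFn fun i => (Z :: t).get (consPerm p τ i))
        = (-1 : ℝ) ^ (p : ℕ) • Equiv.Perm.sign τ •
          (fun w => G (w.take p ++ Z :: w.drop p)) (List.ofFn fun i => t.get (τ i)) := by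
    intro p τ
    have e : (Z :: t).get = (Fin.cons Z t.get : Fin (t.length + 1) → L) := by
      funext i
      refine Fin.cases rfl (fun i => rfl) i
    rw [sign_consPerm, neg_one_pow_mul_smul, e, cons_consPerm, ofFn_insertNth]
  have hX : ∀ (c k' l' : ℕ) (hc : c ≤ t.length),
      (∑ p : Fin (t.length + 1), if (p : ℕ) = c then
        (-1 : ℝ) ^ (p : ℕ) • shuffleSum k' l' (fun w => G (w.take p ++ Z :: w.drop p)) t else 0)
      = (-1 : ℝ) ^ c • shuffleSum k' l' (fun w => G (w.take c ++ Z :: w.drop c)) t :=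
    fun c k' l' hc => sum_fin_ite_eq c hc _
  have h1 : shuffleSum k l G (Z :: t) = ∑ p : Fin (t.length + 1),
      ((if 0 < k then (if (p : ℕ) = 0 then (-1 : ℝ) ^ (p : ℕ) •
          shuffleSum (k - 1) l (fun w => G (w.take p ++ Z :: w.drop p)) t else 0) else 0)
      + (if 0 < l then (if (p : ℕ) = k then (-1 : ℝ) ^ (p : ℕ) •
          shuffleSum k (l - 1) (fun w => G (w.take p ++ Z :: w.drop p)) t else 0) else 0)
      + (if (p : ℕ) = k + l then (-1 : ℝ) ^ (p : ℕ) •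
          shuffleSum k l (fun w => G (w.take p ++ Z :: w.drop p)) t else 0)) := by
    have h0 : shuffleSum k l G (Z :: t) = ∑ σ : Equiv.Perm (Fin (t.length + 1)),
        if σ ∈ shuffles₃ k l (t.length + 1) then
          Equiv.Perm.sign σ • G (List.ofFn fun i => (Z :: t).get (σ i)) else 0 := by
      rw [Finset.sum_ite_mem, Finset.univ_inter]
      rfl
    rw [h0, sum_perm_succ]
    refine Finset.sum_congr rfl fun p _ => ?_
    simp only [hG, mem_shuffles₃_consPerm]
    have hS : ∀ k' l' : ℕ, (-1 : ℝ) ^ (p : ℕ) •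
        shuffleSum k' l' (fun w => G (w.take p ++ Z :: w.drop p)) t
        = ∑ τ : Equiv.Perm (Fin t.length), if τ ∈ shuffles₃ k' l' t.length then
          (-1 : ℝ) ^ (p : ℕ) • Equiv.Perm.sign τ •
            G ((List.ofFn fun i => t.get (τ i)).take p ++ Z ::
              (List.ofFn fun i => t.get (τ i)).drop p) else 0 := by
      intro k' l'
      rw [shuffleSum, Finset.smul_sum, Finset.sum_ite_mem, Finset.univ_inter]
    simp only [hS]
    -- The alternatives exclude each other, since nonempty blocks have distinct starting positions;
    -- thus the sum over the disjunction is the sum of the three sums.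
    by_cases c1 : (p : ℕ) = 0 ∧ 0 < k
    · have c2' : ¬ 0 = k := by omega
      have c3' : ¬ 0 = k + l := by omega
      simp [c1.1, c1.2, c2', c3']
    · by_cases c2 : (p : ℕ) = k ∧ 0 < l
      · have c3 : ¬ ((p : ℕ) = k + l) := by omega
        have c1' : 0 < k → ¬ (p : ℕ) = 0 := by omega
        by_cases hk : 0 < k
        · simp only [c2.1, c2.2, hk]
          simp [c2.2.ne', hk.ne']
        · obtain rfl : k = 0 := by omega
          simp [c2.1, c2.2, c2.2.ne]
      · by_cases c3 : (p : ℕ) = k + l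
        · by_cases hk : 0 < k
          · by_cases hl : 0 < l
            · simp [c3, hk, hl, hl.ne', hk.ne']
            · obtain rfl : l = 0 := by omega
              simp [c3, hk, hk.ne']
          · obtain rfl : k = 0 := by omega
            by_cases hl : 0 < l
            · simp [c3, hl, hl.ne']
            · obtain rfl : l = 0 := by omega
              simp [c3]
        · have c1' : 0 < k → ¬ (p : ℕ) = 0 := by omega
          have c2' : 0 < l → ¬ (p : ℕ) = k := by omega
          have e1 : ∀ P : Prop, ¬ ((p : ℕ) = 0 ∧ 0 < k ∧ P) := fun P h => c1 ⟨h.1, h.2.1⟩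
          have e2 : ∀ P : Prop, ¬ ((p : ℕ) = k ∧ 0 < l ∧ P) := fun P h => c2 ⟨h.1, h.2.1⟩
          simp only [e1, e2, c3, false_and, or_self, if_false, Finset.sum_const_zero, add_zero]
          split_ifs <;> simp_all
  rw [h1, Finset.sum_add_distrib, Finset.sum_add_distrib]
  congr 1
  · congr 1
    · split_ifs with h
      · rw [hX 0 _ _ (Nat.zero_le _)]
        simp
      · simp
    · split_ifs with h
      · rw [hX k _ _ (by omega)]
      · simp
  · split_ifs with h
    · rw [hX (k + l) _ _ h]
    · exact sum_fin_ite_eq_zero _ (by omega) _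

end ShuffleRecursion


/-! ### Shuffle sums as signed distributions of a list into blocks -/

section Unshuffle

variable {L N : Type*} [AddCommGroup N] [Module ℝ N]

/-- The alternating sum over the ways to distribute the entries of a list into three lists, the
first two of length `k` and `l`. -/
def unshuffle : ℕ → ℕ → (List L → List L → List L → N) → List L → N
  | k, l, H, [] => if k = 0 ∧ l = 0 then H [] [] [] else 0
  | k, l, H, Z :: t =>
    (if 0 < k then unshuffle (k - 1) l (fun a b c => H (Z :: a) b c) t else 0)
    + (if 0 < l then (-1 : ℝ) ^ k • unshuffle k (l - 1) (fun a b c => H a (Z :: b) c) t else 0)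
    + (-1 : ℝ) ^ (k + l) • unshuffle k l (fun a b c => H a b (Z :: c)) t

theorem unshuffle_nil (k l : ℕ) (H : List L → List L → List L → N) :
    unshuffle k l H [] = if k = 0 ∧ l = 0 then H [] [] [] else 0 := rfl

theorem unshuffle_cons (k l : ℕ) (H : List L → List L → List L → N) (Z : L) (t : List L) :
    unshuffle k l H (Z :: t) =
      (if 0 < k then unshuffle (k - 1) l (fun a b c => H (Z :: a) b c) t else 0)
      + (if 0 < l then (-1 : ℝ) ^ k • unshuffle k (l - 1) (fun a b c => H a (Z :: b) c) t else 0)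
      + (-1 : ℝ) ^ (k + l) • unshuffle k l (fun a b c => H a b (Z :: c)) t := rfl

/-- A list that is too short cannot fill the first two blocks. This matches the conditional third
term of `shuffleSum_cons` with the unconditional one of `unshuffle_cons`. -/
theorem unshuffle_eq_zero {k l : ℕ} {H : List L → List L → List L → N} {t : List L}
    (h : t.length < k + l) : unshuffle k l H t = 0 := by
  induction t generalizing k l H with
  | nil =>
    rw [unshuffle_nil, if_neg]
    simp only [List.length_nil] at h; omega
  | cons Z t ih =>
    rw [List.length_cons] at h
    rw [unshuffle_cons, ih (H := fun a b c => H a b (Z :: c)) (by omega)]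
    split_ifs with h1 h2 h2
    · rw [ih (by omega), ih (by omega)]; simp
    · rw [ih (by omega)]; simp
    · rw [ih (by omega)]; simp
    · simp

theorem unshuffle_neg (k l : ℕ) (H : List L → List L → List L → N) (t : List L) :
    unshuffle k l (fun a b c => - H a b c) t = - unshuffle k l H t := by
  induction t generalizing k l H with
  | nil => simp only [unshuffle_nil]; split_ifs <;> simp
  | cons Z t ih =>
    simp only [unshuffle_cons, ih]
    split_ifs <;> module

/-- Both sides obey the same recursion: inserting `Z` at position `0`, `k` or `k + l` puts it at the
head of the first, second or third block. -/
theorem shuffleSum_eq_unshuffle {k l : ℕ} (H : List L → List L → List L → N) {t : List L}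
    (h : k + l ≤ t.length) :
    shuffleSum k l (fun w => H (w.take k) ((w.drop k).take l) (w.drop (k + l))) t
      = unshuffle k l H t := by
  induction t generalizing k l H with
  | nil =>
    obtain ⟨rfl, rfl⟩ : k = 0 ∧ l = 0 := by simp only [List.length_nil] at h; omega
    simp [shuffleSum, unshuffle_nil, shuffles₃]
  | cons Z t ih =>
    rw [List.length_cons] at h
    rw [shuffleSum_cons _ _ _ _ _ h, unshuffle_cons]
    congr 1
    · congr 1
      · split_ifs with hk
        · obtain ⟨k, rfl⟩ : ∃ k', k = k' + 1 := ⟨k - 1, by omega⟩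
          rw [Nat.add_sub_cancel, ← ih _ (by omega)]
          refine shuffleSum_congr fun w _ => ?_
          rw [show k + 1 + l = k + l + 1 by omega]
          simp
        · rfl
      · split_ifs with hl
        · obtain ⟨l, rfl⟩ : ∃ l', l = l' + 1 := ⟨l - 1, by omega⟩
          rw [Nat.add_sub_cancel, ← ih _ (by omega)]
          congr 1
          refine shuffleSum_congr fun w hw => ?_
          have hlen : (w.take k).length = k := by simp; omega
          rw [List.take_left' hlen, ← List.drop_drop, List.drop_left' hlen, List.drop_succ_cons,
            List.take_succ_cons, List.drop_drop]
        · rfl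
    · split_ifs with h2
      · rw [← ih _ h2]
        congr 1
        refine shuffleSum_congr fun w hw => ?_
        have hlen : (w.take (k + l)).length = k + l := by simp; omega
        rw [List.drop_left' hlen, List.take_append_of_le_length (by omega), List.take_take,
          min_eq_left (by omega), List.drop_append_of_le_length (by omega),
          List.take_append_of_le_length (by simp; omega), List.drop_take, List.take_take,
          min_eq_left (by omega)]
      · rw [unshuffle_eq_zero (by omega), smul_zero]

/-- With an empty first block, one recursion serves both kinds of shuffles. -/
theorem shuffles₂_eq (k n : ℕ) : shuffles₂ k n = shuffles₃ 0 k n := by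
  unfold shuffles₂ shuffles₃
  simp only [Nat.not_lt_zero, zero_le, true_and, zero_add, false_or]

/-- The alternating sum over the ways to distribute the entries of a list into two lists, the
first of length `k`. -/
def unshuffle₂ (k : ℕ) (H : List L → List L → N) (t : List L) : N :=
  unshuffle 0 k (fun _ a b => H a b) t

theorem unshuffle₂_zero (H : List L → List L → N) (t : List L) :
    unshuffle₂ 0 H t = H [] t := by
  induction t generalizing H with
  | nil => simp [unshuffle₂, unshuffle_nil]
  | cons Z t ih =>
    simp only [unshuffle₂] at ih
    simp [unshuffle₂, unshuffle_cons, ih]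

theorem unshuffle₂_succ_nil (k : ℕ) (H : List L → List L → N) :
    unshuffle₂ (k + 1) H [] = 0 := by
  simp [unshuffle₂, unshuffle_nil]

theorem unshuffle₂_succ_cons (k : ℕ) (H : List L → List L → N) (Z : L) (t : List L) :
    unshuffle₂ (k + 1) H (Z :: t) = unshuffle₂ k (fun a b => H (Z :: a) b) t
      - (-1 : ℝ) ^ k • unshuffle₂ (k + 1) (fun a b => H a (Z :: b)) t := by
  simp [unshuffle₂, unshuffle_cons, sub_eq_add_neg, pow_succ]

theorem unshuffle₂_neg (k : ℕ) (H : List L → List L → N) (t : List L) :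
    unshuffle₂ k (fun a b => - H a b) t = - unshuffle₂ k H t :=
  unshuffle_neg 0 k (fun _ a b => H a b) t

theorem sum_shuffles₂ {k n : ℕ} (H : List L → List L → N) (hk : k ≤ n) (v : Fin n → L) :
    ∑ σ ∈ shuffles₂ k n, Equiv.Perm.sign σ •
        H ((List.ofFn fun i => v (σ i)).take k) ((List.ofFn fun i => v (σ i)).drop k)
      = unshuffle₂ k H (List.ofFn v) := by
  have h := shuffleSum_eq_unshuffle (k := 0) (l := k) (fun _ a b => H a b) (t := List.ofFn v)
    (by simpa using hk)
  rw [shuffleSum_ofFn] at h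
  simpa only [shuffles₂_eq, List.drop_zero, zero_add, unshuffle₂] using h

theorem sum_shuffles₃ {k l n : ℕ} (H : List L → List L → List L → N) (hk : k + l ≤ n)
    (v : Fin n → L) :
    ∑ σ ∈ shuffles₃ k l n, Equiv.Perm.sign σ •
        H ((List.ofFn fun i => v (σ i)).take k) (((List.ofFn fun i => v (σ i)).drop k).take l)
          ((List.ofFn fun i => v (σ i)).drop (k + l))
      = unshuffle k l H (List.ofFn v) := by
  rw [← shuffleSum_eq_unshuffle H (by simpa using hk), shuffleSum_ofFn]

end Unshuffle

/-! ### Agreement of shuffle formulas with the recursive operators -/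

section Bridge

variable {L N : Type*} [AddCommGroup L] [Module ℝ L] [AddCommGroup N] [Module ℝ N]

theorem listInsert_zero_left (p : ℕ) {f : List L → N} (hf : LastLinear f) :
    listInsert p 0 f = 0 := by
  simpa using listInsert_smul_left p (0 : ℝ) (0 : List L → L) hf

/-- Antisymmetry in neighbouring entries. -/
def ListAlt (f : List L → N) : Prop :=
  ∀ l x y l', f (l ++ x :: y :: l') = - f (l ++ y :: x :: l')

theorem ListAlt.contr {f : List L → N} (hf : ListAlt f) (Z : L) : ListAlt (contr Z f) :=
  fun l x y l' => hf (Z :: l) x y l'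

theorem ListAlt.lastAlt {f : List L → N} (hf : ListAlt f) : LastAlt f :=
  fun l x y => hf l x y []

theorem ListAlt.swap {f : List L → N} (hf : ListAlt f) (x y : L) (l : List L) :
    f (x :: y :: l) = - f (y :: x :: l) := hf [] x y l

theorem HasDegree.eq_zero_of_neg {n : ℤ} (hn : n < 0) {f : List L → N} (h : HasDegree n f) :
    f = 0 := by
  funext l
  exact h l (by omega)

theorem HasDegree.contr_succ {n : ℕ} {f : List L → N} (h : HasDegree (n + 1 : ℕ) f) (Z : L) :
    HasDegree n (LieAlgd.contr Z f) := by
  simpa using h.contr Z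

/-- An entry `Z` in the first block contracts `φ`. In the second block it stands behind the value of
`φ`; exchanging the two contracts `f` at the cost of the minus sign in the rule for `ι_Z i_φ`. -/
theorem unshuffle₂_insert {k p : ℕ} (hp : Even (p + k)) {φ : List L → L} (hφ : HasDegree k φ)
    {f : List L → N} (hf : LastLinear f) (ha : ListAlt f) (t : List L) :
    unshuffle₂ k (fun a b => f (φ a :: b)) t = listInsert p φ f t := by
  induction t generalizing k p φ f with
  | nil =>
    cases k with
    | zero => rw [unshuffle₂_zero, listInsert_nil]
    | succ k =>
      rw [unshuffle₂_succ_nil, listInsert_nil, hφ [] (by simp; omega), hf.single_zero]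
  | cons Z t ih =>
    have i2 := ih hp hφ (hf.contr Z) (ha.contr Z)
    have e : (fun a b => f (φ a :: Z :: b)) = fun a b => - contr Z f (φ a :: b) := by
      funext a b; exact ha.swap _ _ _
    cases k with
    | zero =>
      rw [unshuffle₂_zero] at i2 ⊢
      have h0 : contr Z φ = 0 := (hφ.contr Z).eq_zero_of_neg (by simp)
      have hp' : (-1 : ℝ) ^ p = 1 := by
        rw [add_zero] at hp; exact hp.neg_one_pow
      rw [listInsert_cons, h0, listInsert_zero_left _ hf, ← i2, hp', ha.swap]
      simp
    | succ k =>
      have hd := hφ.contr Z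
      have i1 := ih (k := k) (p := p + 1) (by grind) (by simpa using hd) hf ha
      have hs : (-1 : ℝ) ^ p = -(-1) ^ k := by
        rcases Nat.even_or_odd k with h | h
        · have : Odd p := by grind
          rw [h.neg_one_pow, this.neg_one_pow]
        · have : Even p := by grind
          rw [h.neg_one_pow, this.neg_one_pow, neg_neg]
      rw [unshuffle₂_succ_cons, listInsert_cons, e, unshuffle₂_neg, i2, hs]
      change unshuffle₂ k (fun a b => f (contr Z φ a :: b)) t - _ = _
      rw [i1]
      module

variable (cE : L →ₗ[ℝ] N →ₗ[ℝ] N)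

theorem listLie_eq (br : L → L → L) (Z : L) {f : List L → N} (ha : ListAlt f) (t : List L) :
    listLie cE br Z f t
      = cE Z (f t) - unshuffle₂ 1 (fun a b => f (br Z (a.getD 0 0) :: b)) t := by
  induction t generalizing f with
  | nil => simp [listLie_nil, unshuffle₂_succ_nil]
  | cons Y t ih =>
    have e : (fun a b => f (br Z (List.getD a 0 0) :: Y :: b))
        = fun a b => - contr Y f (br Z (a.getD 0 0) :: b) := by
      funext a b; exact ha.swap _ _ _
    rw [listLie_cons, ih (ha.contr Y), unshuffle₂_succ_cons, unshuffle₂_zero, e, unshuffle₂_neg]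
    simp only [List.getD_cons_zero, contr_apply]
    module

/-- This is Cartan's formula `ι_Z d = L_Z - d ι_Z` for the shuffle expression: terms with `Z` in the
first block form `L_Z f` by `listLie_eq`, the others form `-d (ι_Z f)`. The default `0` of `getD` is
never read, as the first blocks have exactly one and two entries. -/
theorem listDeriv_eq (br : L → L → L) {f : List L → N} (ha : ListAlt f) (t : List L) :
    listDeriv cE br f t = unshuffle₂ 1 (fun a b => cE (a.getD 0 0) (f b)) t
      - unshuffle₂ 2 (fun a b => f (br (a.getD 0 0) (a.getD 1 0) :: b)) t := by
  induction t generalizing f with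
  | nil => simp [listDeriv_nil, unshuffle₂_succ_nil]
  | cons Z t ih =>
    have e : (fun a b => f (br (List.getD a 0 0) (List.getD a 1 0) :: Z :: b))
        = fun a b => - contr Z f (br (a.getD 0 0) (a.getD 1 0) :: b) := by
      funext a b; exact ha.swap _ _ _
    rw [listDeriv_cons, ih (ha.contr Z), listLie_eq cE br Z ha, unshuffle₂_succ_cons,
      unshuffle₂_succ_cons, unshuffle₂_zero, e, unshuffle₂_neg]
    simp only [List.getD_cons_zero, List.getD_cons_succ, contr_apply]
    module

theorem neg_one_pow_congr_of_even_add {p k : ℕ} (h : Even (p + k)) :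
    (-1 : ℝ) ^ p = (-1) ^ k := by
  rcases Nat.even_or_odd k with hk | hk
  · have : Even p := by grind
    rw [hk.neg_one_pow, this.neg_one_pow]
  · have : Odd p := by grind
    rw [hk.neg_one_pow, this.neg_one_pow]

section Curvature

variable {R : L → L → L → L}

/-- The recursion for `listCurvAt` contracts `φ` and `ψ` even in degree zero, where `unshuffle`
drops the term. Such contractions are zero and contribute nothing. -/
theorem listCurvAt_of_eq_zero (hR1 : ∀ y z, R 0 y z = 0) (hR2 : ∀ x z, R x 0 z = 0)
    (Z : L) (p : ℕ) {φ ψ : List L → L} (h : φ = 0 ∨ ψ = 0) :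
    listCurvAt R Z p φ ψ = 0 := by
  funext t
  induction t generalizing p φ ψ with
  | nil => rcases h with rfl | rfl <;> simp [listCurvAt, hR1, hR2]
  | cons Y t ih =>
    rw [listCurvAt_cons, ih _ (h.imp (by rintro rfl; rfl) id),
      ih _ (h.imp id (by rintro rfl; rfl))]
    simp

theorem listCurv_of_eq_zero (hR1 : ∀ y z, R 0 y z = 0) (hR2 : ∀ x z, R x 0 z = 0)
    (p q : ℕ) {φ ψ : List L → L} (h : φ = 0 ∨ ψ = 0) :
    listCurv R p q φ ψ = 0 := by
  funext t
  induction t generalizing p q φ ψ with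
  | nil => rfl
  | cons Y t ih =>
    rw [listCurv_cons, ih _ _ (h.imp (by rintro rfl; rfl) id),
      ih _ _ (h.imp id (by rintro rfl; rfl)), listCurvAt_of_eq_zero hR1 hR2 Y p h]
    simp

theorem unshuffle_curvAt (hR1 : ∀ y z, R 0 y z = 0) (hR2 : ∀ x z, R x 0 z = 0)
    {k l p : ℕ} (hp : Even (p + k)) {φ ψ : List L → L}
    (hφ : HasDegree k φ) (hψ : HasDegree l ψ) (Z : L) {t : List L} (ht : t.length = k + l) :
    unshuffle k l (fun a b _ => R (φ a) (ψ b) Z) t = listCurvAt R Z p φ ψ t := by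
  induction t generalizing k l p φ ψ with
  | nil =>
    have hk : k = 0 ∧ l = 0 := by simp only [List.length_nil] at ht; omega
    rw [unshuffle_nil, if_pos hk, listCurvAt]
  | cons Y t ih =>
    rw [List.length_cons] at ht
    rw [unshuffle_cons, listCurvAt_cons, unshuffle_eq_zero (k := k) (l := l) (by omega),
      smul_zero, add_zero, neg_one_pow_congr_of_even_add hp]
    congr 1
    · split_ifs with hk
      · obtain ⟨k, rfl⟩ : ∃ k', k = k' + 1 := ⟨k - 1, by omega⟩
        exact ih (by grind) (hφ.contr_succ Y) hψ (by omega)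
      · have h0 : contr Y φ = 0 := (hφ.contr Y).eq_zero_of_neg (by omega)
        rw [listCurvAt_of_eq_zero hR1 hR2 _ _ (Or.inl h0), Pi.zero_apply]
    · split_ifs with hl
      · obtain ⟨l, rfl⟩ : ∃ l', l = l' + 1 := ⟨l - 1, by omega⟩
        congr 1
        exact ih hp hφ (hψ.contr_succ Y) (by omega)
      · have h0 : contr Y ψ = 0 := (hψ.contr Y).eq_zero_of_neg (by omega)
        rw [listCurvAt_of_eq_zero hR1 hR2 _ _ (Or.inr h0), Pi.zero_apply, smul_zero]

/-- The length leaves exactly one entry for the third block. If `Y` is that entry, it has passed `k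
+ l` others and the rest is `unshuffle_curvAt`, where the third block is empty. -/
theorem unshuffle_curv (hR1 : ∀ y z, R 0 y z = 0) (hR2 : ∀ x z, R x 0 z = 0)
    {k l p q : ℕ} (hp : Even (p + k)) (hq : Even (q + l))
    {φ ψ : List L → L} (hφ : HasDegree k φ) (hψ : HasDegree l ψ) {t : List L}
    (ht : t.length = k + l + 1) :
    unshuffle k l (fun a b c => R (φ a) (ψ b) (c.getD 0 0)) t = listCurv R p q φ ψ t := by
  induction t generalizing k l p q φ ψ with
  | nil => simp at ht
  | cons Y t ih =>
    rw [List.length_cons] at ht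
    have e := neg_one_pow_congr_of_even_add hp
    have e' := neg_one_pow_congr_of_even_add hq
    rw [unshuffle_cons, listCurv_cons, pow_add, pow_add, e, e']
    congr 1
    · congr 1
      · split_ifs with hk
        · obtain ⟨k, rfl⟩ : ∃ k', k = k' + 1 := ⟨k - 1, by omega⟩
          exact ih (by grind) hq (hφ.contr_succ Y) hψ (by omega)
        · have h0 : contr Y φ = 0 := (hφ.contr Y).eq_zero_of_neg (by omega)
          rw [listCurv_of_eq_zero hR1 hR2 _ _ (Or.inl h0), Pi.zero_apply]
      · split_ifs with hl
        · obtain ⟨l, rfl⟩ : ∃ l', l = l' + 1 := ⟨l - 1, by omega⟩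
          congr 1
          exact ih hp (by grind) hφ (hψ.contr_succ Y) (by omega)
        · have h0 : contr Y ψ = 0 := (hψ.contr Y).eq_zero_of_neg (by omega)
          rw [listCurv_of_eq_zero hR1 hR2 _ _ (Or.inr h0), Pi.zero_apply, smul_zero]
    · congr 1
      exact unshuffle_curvAt hR1 hR2 hp hφ hψ Y (by omega)

end Curvature

end Bridge


/-! ### Alternating maps as functions on lists -/

section ListOf

variable {S L N : Type*} [CommRing S] [Algebra ℝ S] [AddCommGroup L] [Module ℝ L] [Module S L]
  [IsScalarTower ℝ S L] [AddCommGroup N] [Module ℝ N] [Module S N] [IsScalarTower ℝ S N]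

/-- An alternating map, extended by zero to lists of all lengths. -/
def listOf {k : ℕ} (η : L [⋀^Fin k]→ₗ[S] N) : List L → N := fun t =>
  if h : t.length = k then η fun i => t.get (i.cast h.symm) else 0

theorem listOf_of_length {k : ℕ} (η : L [⋀^Fin k]→ₗ[S] N) {t : List L} (h : t.length = k) :
    listOf η t = η fun i => t.get (i.cast h.symm) := dif_pos h

theorem listOf_ofFn {k : ℕ} (η : L [⋀^Fin k]→ₗ[S] N) (v : Fin k → L) :
    listOf η (List.ofFn v) = η v := by
  rw [listOf_of_length η List.length_ofFn]
  congr 1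
  funext i
  simp

theorem hasDegree_listOf {k : ℕ} (η : L [⋀^Fin k]→ₗ[S] N) : HasDegree k (listOf η) := by
  intro t ht
  exact dif_neg fun h => ht (by exact_mod_cast h)

theorem exists_eq_ofFn {k : ℕ} {t : List L} (h : t.length = k) :
    ∃ v : Fin k → L, t = List.ofFn v := by
  subst h
  exact ⟨t.get, (List.ofFn_get t).symm⟩

theorem HasDegree.ext {k : ℕ} {f g : List L → N} (hf : HasDegree k f) (hg : HasDegree k g)
    (h : ∀ v : Fin k → L, f (List.ofFn v) = g (List.ofFn v)) : f = g := by
  funext t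
  by_cases ht : t.length = k
  · obtain ⟨v, rfl⟩ := exists_eq_ofFn ht
    exact h v
  · rw [hf t (by exact_mod_cast ht), hg t (by exact_mod_cast ht)]

theorem ofFn_append_singleton {k : ℕ} (v : Fin k → L) (x : L) :
    List.ofFn v ++ [x] = List.ofFn (Fin.snoc (α := fun _ => L) v x) := by
  rw [List.ofFn_succ']
  simp

theorem listOf_append_singleton {k : ℕ} (η : L [⋀^Fin (k + 1)]→ₗ[S] N) (v : Fin k → L)
    (x : L) : listOf η (List.ofFn v ++ [x]) = η (Fin.snoc (α := fun _ => L) v x) := by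
  rw [ofFn_append_singleton, listOf_ofFn]

theorem lastLinear_listOf {k : ℕ} (η : L [⋀^Fin k]→ₗ[S] N) : LastLinear (listOf η) := by
  -- In degree zero a list with an appended entry has the wrong length, so both conditions read `0 =
  -- 0`.
  by_cases hk : ∃ n, k = n + 1
  · obtain ⟨n, rfl⟩ := hk
    constructor
    · intro t x y
      by_cases h : t.length = n
      · obtain ⟨v, rfl⟩ := exists_eq_ofFn h
        simp only [listOf_append_singleton]
        exact η.toMultilinearMap.snoc_add v x y
      · rw [hasDegree_listOf η _ (by simp; omega), hasDegree_listOf η _ (by simp; omega),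
          hasDegree_listOf η _ (by simp; omega), add_zero]
    · intro t c x
      by_cases h : t.length = n
      · obtain ⟨v, rfl⟩ := exists_eq_ofFn h
        simp only [listOf_append_singleton]
        rw [← algebraMap_smul S c x, ← algebraMap_smul S c]
        exact η.toMultilinearMap.snoc_smul v _ x
      · rw [hasDegree_listOf η _ (by simp; omega), hasDegree_listOf η _ (by simp; omega),
          smul_zero]
  · have h0 : ∀ t x, listOf η (t ++ [x]) = 0 := fun t x =>
      hasDegree_listOf η _ fun h => hk ⟨t.length, by simp at h; omega⟩
    exact ⟨by simp [h0], by simp [h0]⟩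

theorem listAlt_listOf {k : ℕ} (η : L [⋀^Fin k]→ₗ[S] N) : ListAlt (listOf η) := by
  intro l x y l'
  by_cases h : l.length + l'.length + 2 = k
  · have h1 : (l ++ x :: y :: l').length = k := by simp; omega
    have h2 : (l ++ y :: x :: l').length = k := by simp; omega
    rw [listOf_of_length η h1, listOf_of_length η h2, eq_comm]
    have hi : l.length < k := by omega
    have hj : l.length + 1 < k := by omega
    have hne : (⟨l.length, hi⟩ : Fin k) ≠ ⟨l.length + 1, hj⟩ := by simp
    rw [← η.map_swap _ hne]
    congr 1
    funext i
    simp only [Function.comp_apply, List.get_eq_getElem, Fin.val_cast]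
    rcases lt_trichotomy (i : ℕ) l.length with hlt | heq | hgt
    · rw [Equiv.swap_apply_of_ne_of_ne (by simp [Fin.ext_iff]; omega)
        (by simp [Fin.ext_iff]; omega), List.getElem_append_left hlt,
        List.getElem_append_left hlt]
    · have : i = ⟨l.length, hi⟩ := Fin.ext heq
      subst this
      rw [Equiv.swap_apply_left]
      simp
    · by_cases h3 : (i : ℕ) = l.length + 1
      · have : i = ⟨l.length + 1, hj⟩ := Fin.ext h3
        subst this
        rw [Equiv.swap_apply_right]
        simp
      · rw [Equiv.swap_apply_of_ne_of_ne (by simp [Fin.ext_iff]; omega)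
          (by simp [Fin.ext_iff]; omega), List.getElem_append_right (by omega),
          List.getElem_append_right (by omega)]
        obtain ⟨c, hc⟩ : ∃ c, (i : ℕ) - l.length = c + 2 := ⟨i - l.length - 2, by omega⟩
        simp only [hc, List.getElem_cons_succ]
  · rw [hasDegree_listOf η _ (by simp; omega), hasDegree_listOf η _ (by simp; omega), neg_zero]

/-- The value `f [φ []]` is taken on a one-entry list, so extension by zero reproduces the
convention that `i_φ` vanishes on `Ω^0`. -/
theorem listInsert_of_hasDegree_zero (p : ℕ) (φ : List L → L) {f : List L → N}
    (hf : HasDegree 0 f) : listInsert p φ f = 0 := by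
  funext t
  induction t generalizing p φ with
  | nil => exact hf _ (by simp)
  | cons Z t ih =>
    have h0 : contr Z f = 0 := (hf.contr Z).eq_zero_of_neg (by simp)
    have h1 : listInsert p φ (0 : List L → N) = 0 := by
      simpa using listInsert_smul_right p φ (0 : ℝ) (0 : List L → N)
    rw [listInsert_cons, ih, h0, h1]
    simp

theorem ofFn_take_drop {k m : ℕ} (w : Fin (k + m) → L) :
    (List.ofFn w).take k = (List.ofFn fun i => w (Fin.castAdd m i)) ∧
      (List.ofFn w).drop k = List.ofFn fun j => w (Fin.natAdd k j) := by
  have h : List.ofFn w = (List.ofFn fun i => w (Fin.castAdd m i)) ++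
      List.ofFn fun j => w (Fin.natAdd k j) := by rw [List.ofFn_add]; rfl
  rw [h]
  exact ⟨List.take_left' (by simp), List.drop_left' (by simp)⟩

theorem listOf_cons_ofFn {k : ℕ} (η : L [⋀^Fin (k + 1)]→ₗ[S] N) (x : L) (v : Fin k → L) :
    listOf η (x :: List.ofFn v) = η (Fin.cons x v) := by
  rw [← listOf_ofFn η, List.ofFn_succ]
  simp

theorem listOf_insertForm {k m : ℕ} (φ : L [⋀^Fin k]→ₗ[S] L)
    (η : L [⋀^Fin (m + 1)]→ₗ[S] N) :
    listOf (insertForm φ η) = listInsert k (listOf φ) (listOf η) := by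
  refine HasDegree.ext (hasDegree_listOf _) ?_ fun v => ?_
  · have h := (hasDegree_listOf φ).listInsert k (hasDegree_listOf η) (lastLinear_listOf η)
    have e : ((k : ℤ) + (m + 1 : ℕ) - 1) = (k + m : ℕ) := by push_cast; ring
    rwa [e] at h
  · rw [← unshuffle₂_insert ⟨k, rfl⟩ (hasDegree_listOf φ) (lastLinear_listOf η)
      (listAlt_listOf η), ← sum_shuffles₂ _ (Nat.le_add_right k m), listOf_ofFn,
      insertForm_apply, insertFun]
    refine Finset.sum_congr rfl fun σ _ => ?_
    rw [(ofFn_take_drop _).1, (ofFn_take_drop _).2, listOf_ofFn, listOf_cons_ofFn]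

theorem extDerivFun_eq_listDeriv (cE : L →ₗ[ℝ] N →ₗ[ℝ] N) (br : L → L → L) {p : ℕ}
    (η : L [⋀^Fin p]→ₗ[S] N) (v : Fin (p + 1) → L) :
    extDerivFun (fun x s => cE x s) br η v = listDeriv cE br (listOf η) (List.ofFn v) := by
  rw [listDeriv_eq cE br (listAlt_listOf η), extDerivFun]
  congr 1
  · rw [← sum_shuffles₂ _ (by omega)]
    refine Finset.sum_congr rfl fun σ _ => ?_
    rw [List.ofFn_succ]
    simp only [List.take_succ_cons, List.drop_succ_cons, List.drop_zero, List.getD_cons_zero,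
      listOf_ofFn]
  · cases p with
    -- A single argument cannot fill a block of two, in accordance with the empty bracket sum for `p
    -- = 0`.
    | zero => exact (unshuffle_eq_zero (by simp)).symm
    | succ q =>
      rw [← sum_shuffles₂ _ (by omega)]
      refine Finset.sum_congr rfl fun σ _ => ?_
      rw [List.ofFn_succ, List.ofFn_succ]
      simp only [List.take_succ_cons, List.drop_succ_cons, List.drop_zero, List.getD_cons_zero,
        List.getD_cons_succ, listOf_cons_ofFn]
      rfl

theorem hasDegree_listLie {cE : L →ₗ[ℝ] N →ₗ[ℝ] N} {br : L → L → L} (Z : L) {n : ℤ}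
    {f : List L → N} (h : HasDegree n f) : HasDegree n (listLie cE br Z f) := by
  intro t ht
  induction t generalizing f n with
  | nil => rw [listLie_nil, h [] ht, map_zero]
  | cons Y t ih =>
    rw [List.length_cons] at ht
    rw [listLie_cons, ih (h.contr Y) (by push_cast at ht; omega),
      h _ (by rwa [List.length_cons]), sub_zero]

theorem hasDegree_listDeriv {cE : L →ₗ[ℝ] N →ₗ[ℝ] N} {br : L → L → L} {n : ℤ}
    {f : List L → N} (h : HasDegree n f) : HasDegree (n + 1) (listDeriv cE br f) := by
  intro t ht
  induction t generalizing f n with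
  | nil => rfl
  | cons Y t ih =>
    rw [List.length_cons] at ht
    push_cast at ht
    rw [listDeriv_cons, ih (h.contr Y) (by omega), hasDegree_listLie Y h t (by omega), sub_zero]

theorem curvFun_eq_listCurv {R : L → L → L → L} (hR1 : ∀ y z, R 0 y z = 0)
    (hR2 : ∀ x z, R x 0 z = 0) {k l : ℕ} (φ : L [⋀^Fin k]→ₗ[S] L) (ψ : L [⋀^Fin l]→ₗ[S] L)
    (v : Fin (k + l + 1) → L) :
    curvFun R φ ψ v = listCurv R k l (listOf φ) (listOf ψ) (List.ofFn v) := by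
  rw [← unshuffle_curv hR1 hR2 ⟨k, rfl⟩ ⟨l, rfl⟩ (hasDegree_listOf φ) (hasDegree_listOf ψ)
    (by simp), ← sum_shuffles₃ _ (Nat.le_succ _), curvFun]
  refine Finset.sum_congr rfl fun σ _ => ?_
  have h := ofFn_take_drop (k := k + l) (m := 1) fun i => v (σ i)
  have h1 := ofFn_take_drop (k := k) (m := l) fun i => v (σ (Fin.castSucc i))
  have e : (List.ofFn fun i => v (σ i)) = (List.ofFn fun i : Fin (k + l) => v (σ i.castSucc)) ++
      [v (σ (Fin.last (k + l)))] := by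
    rw [List.ofFn_succ']
    simp
  rw [e, List.take_append_of_le_length (by simp), List.drop_append_of_le_length (by simp),
    List.take_append_of_le_length (by simp), List.drop_left' (by simp), h1.1, h1.2,
    List.take_of_length_le (by simp), listOf_ofFn, listOf_ofFn, List.getD_cons_zero]

theorem hasDegree_listCurvAt {R : L → L → L → L} (hR1 : ∀ y z, R 0 y z = 0)
    (hR2 : ∀ x z, R x 0 z = 0) (Z : L) {m n : ℤ} (p : ℕ) {φ ψ : List L → L}
    (hφ : HasDegree m φ) (hψ : HasDegree n ψ) : HasDegree (m + n) (listCurvAt R Z p φ ψ) := by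
  intro t ht
  induction t generalizing p m n φ ψ with
  | nil =>
    rw [listCurvAt]
    by_cases hm : (0 : ℤ) = m
    · rw [hψ [] (by simp only [List.length_nil] at ht ⊢; push_cast at ht ⊢; omega), hR2]
    · rw [hφ [] (by simpa using hm), hR1]
  | cons Y t ih =>
    rw [List.length_cons] at ht
    push_cast at ht
    rw [listCurvAt_cons, ih _ (hφ.contr Y) hψ (by omega), ih _ hφ (hψ.contr Y) (by omega),
      smul_zero, add_zero]

theorem hasDegree_listCurv {R : L → L → L → L} (hR1 : ∀ y z, R 0 y z = 0)
    (hR2 : ∀ x z, R x 0 z = 0) {m n : ℤ} (p q : ℕ) {φ ψ : List L → L}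
    (hφ : HasDegree m φ) (hψ : HasDegree n ψ) :
    HasDegree (m + n + 1) (listCurv R p q φ ψ) := by
  intro t ht
  induction t generalizing p q m n φ ψ with
  | nil => rfl
  | cons Y t ih =>
    rw [List.length_cons] at ht
    push_cast at ht
    rw [listCurv_cons, ih _ _ (hφ.contr Y) hψ (by omega), ih _ _ hφ (hψ.contr Y) (by omega),
      hasDegree_listCurvAt hR1 hR2 Y p hφ hψ t (by omega)]
    simp

end ListOf

/-! ### The operators on forms in terms of functions on lists -/

section Geometry

variable {EM : Type*} [NormedAddCommGroup EM] [NormedSpace ℝ EM]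
  {H : Type*} [TopologicalSpace H] {I : ModelWithCorners ℝ EM H}
  {M : Type*} [TopologicalSpace M] [ChartedSpace H M]
  {F : Type*} [NormedAddCommGroup F] [NormedSpace ℝ F]
  {A : M → Type*} [TopologicalSpace (TotalSpace F A)] [∀ x, AddCommGroup (A x)]
  [∀ x, Module ℝ (A x)] [∀ x, TopologicalSpace (A x)] [FiberBundle F A] [VectorBundle ℝ F A]
  [IsManifold I ∞ M]
  {FE : Type*} [NormedAddCommGroup FE] [NormedSpace ℝ FE]
  {E : M → Type*} [TopologicalSpace (TotalSpace FE E)] [∀ x, AddCommGroup (E x)]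
  [∀ x, Module ℝ (E x)] [∀ x, TopologicalSpace (E x)] [FiberBundle FE E] [VectorBundle ℝ FE E]
  {𝒜 : LieAlgebroid I F A}

/-- A form of mixed degree as a function on lists. -/
def toList (ζ : Forms I F A FE E) : List Cₛ^∞⟮I; F, A⟯ → Cₛ^∞⟮I; FE, E⟯ :=
  fun t => ζ t.length t.get

theorem toList_add (ζ θ : Forms I F A FE E) : toList (ζ + θ) = toList ζ + toList θ := rfl

theorem toList_smul (c : ℝ) (ζ : Forms I F A FE E) : toList (c • ζ) = c • toList ζ := rfl

theorem toList_sub (ζ θ : Forms I F A FE E) : toList (ζ - θ) = toList ζ - toList θ := rfl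

theorem toList_zero : toList (0 : Forms I F A FE E) = 0 := rfl

/-- Operator identities can thus be checked on lists, for forms of mixed degree and without casts
between degrees. -/
theorem toList_injective : Function.Injective (toList (I := I) (F := F) (A := A) (FE := FE)
    (E := E)) := by
  intro ζ θ h
  refine DFinsupp.ext fun k => ?_
  ext1 v
  have key : ∀ (t : List Cₛ^∞⟮I; F, A⟯) (ht : t.length = k),
      ζ k (fun i => t.get (i.cast ht.symm)) = θ k (fun i => t.get (i.cast ht.symm)) := by
    rintro t rfl
    exact congrFun h t
  have hv := key (List.ofFn v) List.length_ofFn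
  have e : (fun i => (List.ofFn v).get (i.cast List.length_ofFn.symm)) = v := by
    funext i; simp
  rwa [e] at hv

theorem toList_homog {k : ℕ} (η : Form I F A FE E k) : toList (homog k η) = listOf η := by
  funext t
  by_cases h : t.length = k
  · subst h
    rw [listOf_of_length η rfl, toList, homog, DirectSum.lof_apply]
    rfl
  · rw [hasDegree_listOf η t (by exact_mod_cast h), toList, homog, DirectSum.lof_eq_of,
      DirectSum.of_eq_of_ne _ _ _ h]
    rfl

theorem forms_induction {P : Forms I F A FE E → Prop} (h0 : P 0)
    (hh : ∀ k (η : Form I F A FE E k), P (homog k η))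
    (ha : ∀ ζ θ, P ζ → P θ → P (ζ + θ)) (ζ : Forms I F A FE E) : P ζ :=
  DirectSum.induction_on ζ h0 hh ha

theorem lastLinear_toList (ζ : Forms I F A FE E) : LastLinear (toList ζ) := by
  induction ζ using forms_induction with
  | h0 => exact ⟨by simp [toList_zero], by simp [toList_zero]⟩
  | hh k η => rw [toList_homog]; exact lastLinear_listOf η
  | ha ζ θ h1 h2 =>
    refine ⟨fun l x y => ?_, fun l c x => ?_⟩
    · simp only [toList_add, Pi.add_apply, h1.add, h2.add]; abel
    · simp only [toList_add, Pi.add_apply, h1.smul, h2.smul, smul_add]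

theorem lastAlt_toList (ζ : Forms I F A FE E) : LastAlt (toList ζ) := by
  induction ζ using forms_induction with
  | h0 => intro l x y; simp [toList_zero]
  | hh k η => rw [toList_homog]; exact (listAlt_listOf η).lastAlt
  | ha ζ θ h1 h2 =>
    intro l x y
    rw [toList_add, Pi.add_apply, Pi.add_apply, h1 l x y, h2 l x y]; abel

/-- A connection as an `ℝ`-bilinear map. -/
def Connection.bilin (D : Connection FE E 𝒜) :
    Cₛ^∞⟮I; F, A⟯ →ₗ[ℝ] Cₛ^∞⟮I; FE, E⟯ →ₗ[ℝ] Cₛ^∞⟮I; FE, E⟯ :=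
  LinearMap.mk₂ ℝ D.cov D.add_cov
    (fun c X s => by rw [real_smul_section, D.smul_cov, ← real_smul_section])
    D.cov_add (fun c X s => D.cov_smul X c s)

theorem toList_interior {k : ℕ} (φ : Form I F A F A k) (ζ : Forms I F A FE E) :
    toList (interior k φ ζ) = listInsert k (listOf φ) (toList ζ) := by
  induction ζ using forms_induction with
  | h0 =>
    rw [map_zero, toList_zero]
    simpa using (listInsert_smul_right k (listOf φ) (0 : ℝ)
      (0 : List Cₛ^∞⟮I; F, A⟯ → Cₛ^∞⟮I; FE, E⟯)).symm
  | hh m η =>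
    have h : interior k φ (homog m η) = insertOn k m φ η := DirectSum.toModule_lof ℝ m η
    rw [h, toList_homog]
    cases m with
    | zero =>
      rw [listInsert_of_hasDegree_zero k _ (hasDegree_listOf η)]
      rfl
    | succ m =>
      rw [← listOf_insertForm, ← toList_homog]
      rfl
  | ha ζ θ h1 h2 => rw [map_add, toList_add, h1, h2, toList_add, listInsert_add_right]

theorem listOf_extDerivForm (D : Connection FE E 𝒜) {p : ℕ} (η : Form I F A FE E p) :
    listOf (extDerivForm D η) = listDeriv D.bilin 𝒜.bracket (listOf η) := by
  refine HasDegree.ext (hasDegree_listOf _) ?_ fun v => ?_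
  · have h := hasDegree_listDeriv (cE := D.bilin) (br := 𝒜.bracket) (hasDegree_listOf η)
    exact_mod_cast h
  · rw [listOf_ofFn, extDerivForm_apply, ← extDerivFun_eq_listDeriv]
    rfl

theorem toList_extDeriv (D : Connection FE E 𝒜) (ζ : Forms I F A FE E) :
    toList (extDeriv D ζ) = listDeriv D.bilin 𝒜.bracket (toList ζ) := by
  induction ζ using forms_induction with
  | h0 =>
    rw [map_zero, toList_zero]
    simpa using (listDeriv_smul D.bilin 𝒜.bracket (0 : ℝ)
      (0 : List Cₛ^∞⟮I; F, A⟯ → Cₛ^∞⟮I; FE, E⟯)).symm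
  | hh m η =>
    have h : extDeriv D (homog m η) = homog (m + 1) (extDerivForm D η) :=
      DirectSum.toModule_lof ℝ m η
    rw [h, toList_homog, toList_homog, listOf_extDerivForm]
  | ha ζ θ h1 h2 => rw [map_add, toList_add, h1, h2, toList_add, listDeriv_add]

/-- Torsion-freeness supplies the bracket identity required by `listNabla_eq`; the rest is the
translation of `i_φ` and `d`. -/
theorem toList_nabla_homog {DA : Connection F A 𝒜} (hDA : DA.IsTorsionFree)
    (D : Connection FE E 𝒜) {k : ℕ} (φ : Form I F A F A k) (ζ : Forms I F A FE E) :
    toList (nabla DA D (homog k φ) ζ)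
      = listNabla DA.bilin D.bilin k (listOf φ) (toList ζ) := by
  have h : nabla DA D (homog k φ) = nablaHom DA D k φ := DirectSum.toModule_lof ℝ k φ
  rw [listNabla_eq DA.bilin D.bilin (fun x y => (hDA x y).symm) k _ (lastLinear_toList ζ),
    ← toList_extDeriv, ← toList_interior, ← toList_interior, ← toList_extDeriv,
    ← listOf_extDerivForm, ← toList_interior, h]
  rfl

/-- The operator has to be formed for `∇_φ ψ`, an element of the direct sum whose type records no
degree. Being concentrated in degree `n`, it equals its component there. -/
theorem toList_nabla {DA : Connection F A 𝒜} (hDA : DA.IsTorsionFree)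
    (D : Connection FE E 𝒜) {n : ℕ} {Φ : Forms I F A F A} (hΦ : HasDegree n (toList Φ))
    (ζ : Forms I F A FE E) :
    toList (nabla DA D Φ ζ) = listNabla DA.bilin D.bilin n (toList Φ) (toList ζ) := by
  have h : Φ = homog n (Φ n) := by
    refine toList_injective ?_
    rw [toList_homog]
    refine hΦ.ext (hasDegree_listOf _) fun v => ?_
    -- Forgetting that the list comes from `v` allows `n` to be replaced by its length.
    obtain ⟨t, ht⟩ : ∃ t, t = List.ofFn v := ⟨_, rfl⟩
    rw [← ht]
    have hl : t.length = n := by rw [ht, List.length_ofFn]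
    clear ht
    subst hl
    rw [listOf_of_length _ rfl]
    rfl
  have h2 := toList_nabla_homog hDA D (Φ n) ζ
  rw [← h, ← toList_homog, ← h] at h2
  exact h2

theorem listOf_curvForm {DA : Connection F A 𝒜} (hDA : DA.IsTorsionFree) {k l : ℕ}
    (φ : Form I F A F A k) (ψ : Form I F A F A l) :
    listOf (curvForm DA φ ψ)
      = listCurv (torsionFreeCurv DA.bilin) k l (listOf φ) (listOf ψ) := by
  have hR : DA.curvature = torsionFreeCurv DA.bilin := by
    funext x y z
    rw [Connection.curvature, ← hDA x y]
    rfl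
  have hR1 : ∀ y z, torsionFreeCurv DA.bilin 0 y z = 0 := by simp [torsionFreeCurv]
  have hR2 : ∀ x z, torsionFreeCurv DA.bilin x 0 z = 0 := by simp [torsionFreeCurv]
  refine HasDegree.ext (hasDegree_listOf _) ?_ fun v => ?_
  · have h := hasDegree_listCurv hR1 hR2 k l (hasDegree_listOf φ) (hasDegree_listOf ψ)
    exact_mod_cast h
  · rw [listOf_ofFn, curvForm_apply, hR, curvFun_eq_listCurv hR1 hR2]

/-- The degree is given by an equation so that `∇_ψ φ`, naturally of degree `l + k`, can be assigned
the index `k + l`. -/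
theorem hasDegree_nabla {DA : Connection F A 𝒜} (hDA : DA.IsTorsionFree) {k l n : ℕ}
    (hn : k + l = n) (φ : Form I F A F A k) (ψ : Form I F A F A l) :
    HasDegree n (toList (nabla DA DA (homog k φ) (homog l ψ))) := by
  subst hn
  rw [toList_nabla_homog hDA, toList_homog]
  exact_mod_cast (hasDegree_listOf φ).listNabla DA.bilin DA.bilin k
    (hasDegree_listOf ψ) (lastLinear_listOf ψ)

theorem nabla_nabla_apply {DA : Connection F A 𝒜} (hDA : DA.IsTorsionFree)
    {DE : Connection FE E 𝒜} (hDE : DE.IsFlat) {k l : ℕ} (φ : Form I F A F A k)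
    (ψ : Form I F A F A l) (ζ : Forms I F A FE E) :
    nabla DA DE (homog k φ) (nabla DA DE (homog l ψ) ζ)
        - (-1 : ℝ) ^ (k * l) • nabla DA DE (homog l ψ) (nabla DA DE (homog k φ) ζ)
      = nabla DA DE (nabla DA DA (homog k φ) (homog l ψ)) ζ
        - (-1 : ℝ) ^ (k * l) • nabla DA DE (nabla DA DA (homog l ψ) (homog k φ)) ζ
        - interior (k + l + 1) (curvForm DA φ ψ) ζ := by
  refine toList_injective ?_
  -- Torsion-freeness on `A` removes the bracket from the flatness of `E`, giving the form used by
  -- `listNabla_listNabla`.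
  have hflat : ∀ x y n, DE.bilin x (DE.bilin y n) - DE.bilin y (DE.bilin x n)
      - DE.bilin (DA.bilin x y - DA.bilin y x) n = 0 := by
    intro x y n
    have h := hDE x y n
    rw [Connection.curvature, ← hDA x y] at h
    exact h
  have h := listNabla_listNabla DA.bilin DE.bilin hflat (p := k) (q := l) rfl
    (hasDegree_listOf φ).hasParity (hasDegree_listOf ψ).hasParity
    (lastLinear_toList ζ) (lastAlt_toList ζ)
  rw [toList_sub, toList_sub, toList_sub, toList_smul, toList_smul,
    toList_nabla hDA DE (hasDegree_nabla hDA rfl φ ψ),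
    toList_nabla hDA DE (hasDegree_nabla hDA (add_comm l k) ψ φ), toList_nabla_homog hDA,
    toList_nabla_homog hDA, toList_nabla_homog hDA, toList_nabla_homog hDA,
    toList_nabla_homog hDA, toList_nabla_homog hDA, toList_homog, toList_homog,
    toList_interior, listOf_curvForm hDA]
  exact h

end Geometry

end LieAlgd

end

/-! ### The commutator formula -/

theorem theorem2
    {EM : Type*} [NormedAddCommGroup EM] [NormedSpace ℝ EM] [FiniteDimensional ℝ EM]
    {H : Type*} [TopologicalSpace H] {I : ModelWithCorners ℝ EM H}
    {M : Type*} [TopologicalSpace M] [ChartedSpace H M] [IsManifold I ∞ M] [T2Space M]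
    {F : Type*} [NormedAddCommGroup F] [NormedSpace ℝ F] [FiniteDimensional ℝ F]
    {A : M → Type*} [TopologicalSpace (Bundle.TotalSpace F A)] [∀ x, AddCommGroup (A x)]
    [∀ x, Module ℝ (A x)] [∀ x, TopologicalSpace (A x)] [FiberBundle F A] [VectorBundle ℝ F A]
    [ContMDiffVectorBundle ∞ F A I]
    {FE : Type*} [NormedAddCommGroup FE] [NormedSpace ℝ FE] [FiniteDimensional ℝ FE]
    {E : M → Type*} [TopologicalSpace (Bundle.TotalSpace FE E)] [∀ x, AddCommGroup (E x)]
    [∀ x, Module ℝ (E x)] [∀ x, TopologicalSpace (E x)] [FiberBundle FE E]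
    [VectorBundle ℝ FE E] [ContMDiffVectorBundle ∞ FE E I]
    (𝒜 : LieAlgd.LieAlgebroid I F A)
    (DA : LieAlgd.Connection F A 𝒜) (hDA : DA.IsTorsionFree)
    (DE : LieAlgd.Connection FE E 𝒜) (hDE : DE.IsFlat)
    (k l : ℕ) (φ : LieAlgd.Form I F A F A k) (ψ : LieAlgd.Form I F A F A l) :
    LieAlgd.gradedCommutator k l
        (LieAlgd.nabla DA DE (LieAlgd.homog k φ)) (LieAlgd.nabla DA DE (LieAlgd.homog l ψ))
      = LieAlgd.nabla DA DE (LieAlgd.nabla DA DA (LieAlgd.homog k φ) (LieAlgd.homog l ψ))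
        - (-1 : ℝ) ^ (k * l) •
          LieAlgd.nabla DA DE (LieAlgd.nabla DA DA (LieAlgd.homog l ψ) (LieAlgd.homog k φ))
        - LieAlgd.interior (k + l + 1) (LieAlgd.curvForm DA φ ψ) := by
  exact LinearMap.ext fun ζ => LieAlgd.nabla_nabla_apply hDA hDE φ ψ ζ
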